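/- Let $\mathcal H_1,\mathcal H_2$ be complex Hilbert spaces of arbitrary dimension, and let $\mathcal B_t(\mathcal H)$ and $\mathcal B(\mathcal H)$ denote the trace-class and the bounded operators on $\mathcal H$. A channel is a trace-preserving completely positive linear map $\Phi:\mathcal B_t(\mathcal H)\to\mathcal B_t(\mathcal K)$; its dual $\Phi^*:\mathcal B(\mathcal K)\to\mathcal B(\mathcal H)$ is given by $\mathrm{Tr}(\Phi(\rho)A)=\mathrm{Tr}(\rho\,\Phi^*(A))$ (the dual of any completely positive linear map is defined in the same way). An effect is an operator $0\le A\le \mathbf 1$; it is sharp if it is an orthogonal projection. Let $\mathcal E:\mathcal B_t(\mathcal H_1)\to\mathcal B_t(\mathcal H_2)$ be a channel with operator-sum form $\mathcal E(\rho)=\sum_{k=0}^\infty E_k\rho E_k^\dagger$, where the $E_k:\mathcal H_1\to\mathcal H_2$ are bounded. An effect $A$ on $\mathcal H_1$ is corrected by a completely positive map $\mathcal R:\mathcal B_t(\mathcal H_2)\to\mathcal B_t(\mathcal H_1)$ if $A=\mathcal E^*(\mathcal R^*(A))$, and it is correctable if it is corrected by some channel. Let $$\mathcal A=\{A\in\mathcal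 B(\mathcal H_1): [A,E_i^\dagger E_j]=0 \text{ for all } i,j\},$$ which is a von Neumann algebra. Put $\lambda_i=2^{-i}$, $\mathcal E_\lambda(A)=\sum_{i}\lambda_iE_iAE_i^\dagger$, $S=\mathcal E_\lambda(\mathbf 1)^{-1/2}$ (the possibly unbounded inverse of $\mathcal E_\lambda(\mathbf 1)^{1/2}$ restricted to the orthogonal complement of its kernel), and $$\mathcal R(\rho)=\mathcal E_\lambda^*(S\rho S),\qquad\text{i.e.}\quad \langle x,\mathcal R(\rho)y\rangle=\sum_i\lambda_i\langle SE_ix,\rho\, SE_iy\rangle .$$ Let $Q$ be the orthogonal projection of $\mathcal H_2$ onto the closed linear span of the ranges of the $E_i$. Then: 1. $\mathcal A$ is the linear span of the effects it contains. 2. The ranges of the $E_i$ lie in the domain of $S$, and the formula above defines a unique linear map $\mathcal R:\mathcal B_t(\mathcal H_2)\to\mathcal B_t(\mathcal H_1)$. It is completely positive, with $\mathrm{Tr}\,\mathcal R(\rho)=\mathrm{Tr}(Q\rho)$ for all $\rho\in\mathcal B_t(\mathcal H_2)$; in particular it is a channel if the ranges of the $E_i$ span a dense subspace of $\mathcal H_2$.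 3. Every effect in $\mathcal A$ is corrected by $\mathcal R$. Consequently, for every POVM $X$ on a measurable space with all effects $X(\omega)$ in $\mathcal A$, all the $X(\omega)$ are corrected by $\mathcal R$. 4. For every state $\sigma$ on $\mathcal H_1$ (a positive operator of trace one), the map $\mathcal R_\sigma(\rho)=\mathcal R(\rho)+\mathrm{Tr}((\mathbf 1-Q)\rho)\,\sigma$ is a channel that corrects all the effects in $\mathcal A$, and all the POVMs with effects in $\mathcal A$. 5. $\mathcal A$ contains every correctable sharp effect. -/

import Mathlib

open scoped InnerProductSpace ComplexOrder

noncomputable section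

namespace QECAlg

section Operators

variable {H : Type*} [NormedAddCommGroup H] [InnerProductSpace ℂ H] [CompleteSpace H]

/-- An orthonormal (Hilbert) basis of `H`, chosen once and for all to compute traces. -/
def stdBasis (H : Type*) [NormedAddCommGroup H] [InnerProductSpace ℂ H] [CompleteSpace H] :
    HilbertBasis (Classical.choose (exists_hilbertBasis ℂ H) : Set H) ℂ H :=
  Classical.choose (Classical.choose_spec (exists_hilbertBasis ℂ H))

/-- The trace `∑ᵢ ⟨i|T|i⟩`; for trace-class `T` the sum converges absolutely and does not depend
on the basis. -/
def trace (T : H →L[ℂ] H) : ℂ :=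
  ∑' i, ⟪stdBasis H i, T (stdBasis H i)⟫_ℂ

/-- A positive operator `ρ` (so that `√(ρ†ρ) = ρ`) with finite trace. -/
def IsPosTraceClass (ρ : H →L[ℂ] H) : Prop :=
  0 ≤ ρ ∧ Summable fun i => ⟪stdBasis H i, ρ (stdBasis H i)⟫_ℂ

/-- The space `B_t(H)` of trace-class operators. An operator is trace class if and only if it is a
linear combination of positive operators of finite trace. -/
def traceClass (H : Type*) [NormedAddCommGroup H] [InnerProductSpace ℂ H] [CompleteSpace H] :
    Submodule ℂ (H →L[ℂ] H) :=
  Submodule.span ℂ {ρ | IsPosTraceClass ρ}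

/-- A state: a positive trace-class operator of trace one. -/
def IsState (ρ : traceClass H) : Prop :=
  0 ≤ (ρ : H →L[ℂ] H) ∧ trace (ρ : H →L[ℂ] H) = 1

/-- An effect: `0 ≤ A ≤ 1`. -/
def IsEffect (A : H →L[ℂ] H) : Prop := 0 ≤ A ∧ A ≤ 1

/-- A sharp effect: an effect that is an orthogonal projection, `P² = P = P†`. -/
def IsSharpEffect (P : H →L[ℂ] H) : Prop := IsEffect P ∧ IsStarProjection P

/-- Positivity of an `n × n` block operator acting on `H ⊕ ⋯ ⊕ H`. -/
def IsPosBlock {n : ℕ} (M : Fin n → Fin n → (H →L[ℂ] H)) : Prop :=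
  ∀ v : Fin n → H, 0 ≤ ∑ i, ∑ j, ⟪v i, M i j (v j)⟫_ℂ

/-- The (in general unbounded) operator `T^{-1/2}` of a positive bounded operator `T`: the inverse
of the restriction of `T^{1/2}` to the orthogonal complement of its kernel. Its domain is the range
of `T^{1/2}`. -/
def invSqrt (T : H →L[ℂ] H) : H →ₗ.[ℂ] H :=
  ((CFC.sqrt T : H →L[ℂ] H).toLinearMap.toPMap
    (LinearMap.ker (CFC.sqrt T : H →L[ℂ] H).toLinearMap)ᗮ).inverse

/-- A positive operator valued measure on `Ω`, countably additive in the weak sense. -/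
structure POVM (Ω : Type*) [MeasurableSpace Ω] (H : Type*) [NormedAddCommGroup H]
    [InnerProductSpace ℂ H] [CompleteSpace H] where
  effect : Set Ω → (H →L[ℂ] H)
  isEffect : ∀ ω, MeasurableSet ω → IsEffect (effect ω)
  univ : effect Set.univ = 1
  iUnion : ∀ s : ℕ → Set Ω, (∀ n, MeasurableSet (s n)) → Pairwise (Function.onFun Disjoint s) →
    ∀ x y : H, HasSum (fun n => ⟪x, effect (s n) y⟫_ℂ) ⟪x, effect (⋃ n, s n) y⟫_ℂ

end Operators

section Channels

variable {H K : Type*} [NormedAddCommGroup H] [InnerProductSpace ℂ H] [CompleteSpace H]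
  [NormedAddCommGroup K] [InnerProductSpace ℂ K] [CompleteSpace K]

/-- Complete positivity: all the maps `id_n ⊗ Φ` preserve positivity. -/
def IsCompletelyPositive (Φ : traceClass H →ₗ[ℂ] traceClass K) : Prop :=
  ∀ (n : ℕ) (M : Fin n → Fin n → traceClass H),
    IsPosBlock (fun i j => (M i j : H →L[ℂ] H)) →
    IsPosBlock (fun i j => (Φ (M i j) : K →L[ℂ] K))

/-- A channel: a trace-preserving completely positive linear map `B_t(H) → B_t(K)`. -/
structure IsChannel (Φ : traceClass H →ₗ[ℂ] traceClass K) : Prop where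
  completelyPositive : IsCompletelyPositive Φ
  tracePreserving : ∀ ρ, trace (Φ ρ : K →L[ℂ] K) = trace (ρ : H →L[ℂ] H)

/-- `B` is the image of `A` under the dual map: `Tr(Φ(ρ) A) = Tr(ρ B)` for all `ρ ∈ B_t(H)`. -/
def IsDualAt (Φ : traceClass H →ₗ[ℂ] traceClass K) (A : K →L[ℂ] K) (B : H →L[ℂ] H) : Prop :=
  ∀ ρ : traceClass H, trace ((Φ ρ : K →L[ℂ] K) ∘L A) = trace ((ρ : H →L[ℂ] H) ∘L B)

open Classical in
/-- The dual `Φ* : B(K) → B(H)`, determined by `Tr(Φ(ρ) A) = Tr(ρ Φ*(A))`. Such an operator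
`Φ*(A)` is unique, and it exists for every completely positive `Φ`. -/
def dual (Φ : traceClass H →ₗ[ℂ] traceClass K) (A : K →L[ℂ] K) : H →L[ℂ] H :=
  if h : ∃ B, IsDualAt Φ A B then Classical.choose h else 0

/-- The operator-sum form `Φ(ρ) = ∑ₖ Eₖ ρ Eₖ†` (weakly convergent sum). -/
def IsOperatorSum (Φ : traceClass H →ₗ[ℂ] traceClass K) (E : ℕ → H →L[ℂ] K) : Prop :=
  ∀ (ρ : traceClass H) (x y : K),
    HasSum (fun k => ⟪x, (E k ∘L (ρ : H →L[ℂ] H) ∘L (E k).adjoint) y⟫_ℂ) ⟪x, (Φ ρ : K →L[ℂ] K) y⟫_ℂ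

/-- `A` is corrected by `R` for `𝓔`: `A = 𝓔*(R*(A))`. -/
def IsCorrectedBy (𝓔 : traceClass H →ₗ[ℂ] traceClass K) (R : traceClass K →ₗ[ℂ] traceClass H)
    (A : H →L[ℂ] H) : Prop :=
  A = dual 𝓔 (dual R A)

/-- `A` is correctable for `𝓔`: some channel corrects it. -/
def IsCorrectable (𝓔 : traceClass H →ₗ[ℂ] traceClass K) (A : H →L[ℂ] H) : Prop :=
  ∃ R : traceClass K →ₗ[ℂ] traceClass H, IsChannel R ∧ IsCorrectedBy 𝓔 R A

/-- The von Neumann algebra `𝒜` of the operators commuting with all `Eᵢ† Eⱼ`. -/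
def correctableAlgebra (E : ℕ → H →L[ℂ] K) : VonNeumannAlgebra H where
  toStarSubalgebra :=
    StarSubalgebra.centralizer ℂ {T | ∃ i j, T = (E i).adjoint ∘L E j}
  centralizer_centralizer' := by
    change Set.centralizer (Set.centralizer
      ((StarSubalgebra.centralizer ℂ {T | ∃ i j, T = (E i).adjoint ∘L E j} :
        StarSubalgebra ℂ (H →L[ℂ] H)) : Set (H →L[ℂ] H))) = _
    rw [StarSubalgebra.coe_centralizer, Set.centralizer_centralizer_centralizer]
    rfl

theorem mem_correctableAlgebra {E : ℕ → H →L[ℂ] K} {A : H →L[ℂ] H} :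
    A ∈ correctableAlgebra E ↔ ∀ i j, Commute A ((E i).adjoint ∘L E j) := by
  change A ∈ StarSubalgebra.centralizer ℂ {T | ∃ i j, T = (E i).adjoint ∘L E j} ↔ _
  rw [StarSubalgebra.mem_centralizer_iff]
  constructor
  · intro h i j
    exact (h _ ⟨i, j, rfl⟩).1.symm
  · rintro h _ ⟨i, j, rfl⟩
    refine ⟨(h i j).symm.eq, ?_⟩
    have hs : star ((E i).adjoint ∘L E j) = (E j).adjoint ∘L E i := by
      rw [ContinuousLinearMap.star_eq_adjoint, ContinuousLinearMap.adjoint_comp,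
        ContinuousLinearMap.adjoint_adjoint]
    rw [hs]
    exact (h j i).symm.eq

/-- The weights `λᵢ = 2⁻ⁱ`. -/
def weight (i : ℕ) : ℂ := (1 / 2) ^ i

/-- `𝓔_λ(A) = ∑ᵢ λᵢ Eᵢ A Eᵢ†`, a norm-convergent sum since `‖Eᵢ‖ ≤ 1` for the elements of a
channel. -/
def regularized (E : ℕ → H →L[ℂ] K) (A : H →L[ℂ] H) : K →L[ℂ] K :=
  ∑' i, weight i • (E i ∘L A ∘L (E i).adjoint)

/-- `R(ρ) = 𝓔_λ*(S ρ S)` with `S = 𝓔_λ(1)^{-1/2}` and `𝓔_λ*(σ) = ∑ᵢ λᵢ Eᵢ† σ Eᵢ`. Since `S` may be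
unbounded, this is read as `⟨x, R(ρ) y⟩ = ∑ᵢ λᵢ ⟨S Eᵢ x, ρ S Eᵢ y⟩`, which includes that the
ranges of the `Eᵢ` lie in the domain of `S`. -/
def IsRecoveryMap (E : ℕ → H →L[ℂ] K) (R : traceClass K →ₗ[ℂ] traceClass H) : Prop :=
  ∃ hdom : ∀ i x, E i x ∈ (invSqrt (regularized E 1)).domain,
    ∀ (ρ : traceClass K) (x y : H),
      HasSum (fun i => weight i *
          ⟪invSqrt (regularized E 1) ⟨E i x, hdom i x⟩,
            (ρ : K →L[ℂ] K) (invSqrt (regularized E 1) ⟨E i y, hdom i y⟩)⟫_ℂ)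
        ⟪x, (R ρ : H →L[ℂ] H) y⟫_ℂ

/-- The closed linear span of the ranges of the `Eᵢ`. -/
def rangeSpan (E : ℕ → H →L[ℂ] K) : Submodule ℂ K :=
  (⨆ i, LinearMap.range (E i).toLinearMap).topologicalClosure

instance (E : ℕ → H →L[ℂ] K) : CompleteSpace (rangeSpan E) :=
  (Submodule.isClosed_topologicalClosure _).completeSpace_coe

end Channels

end QECAlg

end

open scoped InnerProductSpace ComplexOrder

noncomputable section

namespace QECAlg

set_option linter.unusedSectionVars false

/-! ### Trace-class operators as square-summable sums of rank-one operators -/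

section TraceTheory

variable {H : Type*} [NormedAddCommGroup H] [InnerProductSpace ℂ H] [CompleteSpace H]
  {ι κ : Type*}

/-! Put the operators `E i` into two columns. The column `V x = (Eᵢ x)ᵢ` is an isometry from `H`
into `K ⊕ K ⊕ ⋯`, because the channel preserves the trace, and the dual of the channel is `B ↦ V†(B
⊕ B ⊕ ⋯)V`. The weighted column `W y = (√λᵢ Eᵢ† y)ᵢ` is bounded, because the weights are summable,
and `W†W` is `𝓔_λ(1)`. In the polar decomposition `W = U|W|` one has `S Eᵢ = λᵢ^{-1/2} U† coordᵢ†`: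
the weights cancel and the unbounded `S` disappears. Thus `R` is the operator sum with elements
`coordᵢ U`, and `R*(A) = U†(A ⊕ A ⊕ ⋯)U`. Existence, uniqueness and complete positivity follow, and
`R*(1) = U†U = Q` gives the trace formula.

The blocks of `WW†` are multiples of `Eᵢ†Eⱼ`, so for `A` in the algebra `A ⊕ A ⊕ ⋯` commutes with
`WW†`. Then `polar_intertwine` yields `R*(A) Eⱼ = Eⱼ A`, whence `𝓔*(R*(A)) = ∑ Eⱼ†Eⱼ A = A`. Adding
a multiple of `1 - Q` to `R*(A)` changes nothing, since `(1 - Q)Eⱼ = 0`; this handles the completion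
by a state.

Conversely, let `P = ∑ Eᵢ† B Eᵢ` with `P` a projection and `B` an effect. Positivity of each term
forces `B Eᵢ = 0` on the kernel of `P` and `B Eᵢ = Eᵢ` on its range, so `B Eᵢ = Eᵢ P`; with the
adjoint relation, `P` commutes with every `Eᵢ†Eⱼ`. -/

theorem nonneg_iff_inner {T : H →L[ℂ] H} : 0 ≤ T ↔ ∀ x, 0 ≤ ⟪x, T x⟫_ℂ := by
  rw [ContinuousLinearMap.nonneg_iff_isPositive]
  refine ⟨fun h x => h.inner_nonneg_right x, fun h => ?_⟩
  rw [ContinuousLinearMap.isPositive_iff_complex]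
  intro x
  have h1 : 0 ≤ ⟪T x, x⟫_ℂ := by
    rw [← inner_conj_symm]
    exact star_nonneg_iff.2 (h x)
  have h2 := Complex.nonneg_iff.1 h1
  refine ⟨?_, h2.1⟩
  apply Complex.ext
  · simp
  · simpa using h2.2

theorem sqrt_isSymmetric (T : H →L[ℂ] H) (x y : H) :
    ⟪CFC.sqrt T x, y⟫_ℂ = ⟪x, CFC.sqrt T y⟫_ℂ :=
  ((ContinuousLinearMap.nonneg_iff_isPositive _).1
    (CFC.sqrt_nonneg T)).inner_left_eq_inner_right x y

theorem sqrt_apply_sqrt_apply {T : H →L[ℂ] H} (hT : 0 ≤ T) (x : H) :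
    CFC.sqrt T (CFC.sqrt T x) = T x := by
  conv_rhs => rw [← CFC.sqrt_mul_sqrt_self T hT]
  rfl

theorem hasSum_norm_inner_sq (b : HilbertBasis κ ℂ H) (x : H) :
    HasSum (fun k => ‖⟪b k, x⟫_ℂ‖ ^ 2) (‖x‖ ^ 2) := by
  have h := b.hasSum_inner_mul_inner x x
  rw [inner_self_eq_norm_sq_to_K] at h
  have h1 : (fun k => ⟪x, b k⟫_ℂ * ⟪b k, x⟫_ℂ) = fun k => ((‖⟪b k, x⟫_ℂ‖ ^ 2 : ℝ) : ℂ) := by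
    ext k
    rw [← inner_conj_symm x (b k), RCLike.conj_mul]
    norm_cast
  have h2 : ((‖x‖ : ℂ) ^ 2) = ((‖x‖ ^ 2 : ℝ) : ℂ) := by norm_cast
  rw [h1] at h
  exact Complex.hasSum_ofReal.1 (h2 ▸ h)

theorem summable_prod_norm_inner_sq (b : HilbertBasis κ ℂ H) {v : ι → H}
    (hv : Summable fun i => ‖v i‖ ^ 2) :
    Summable fun p : ι × κ => ‖⟪b p.2, v p.1⟫_ℂ‖ ^ 2 := by
  rw [summable_prod_of_nonneg (fun _ => sq_nonneg _)]
  refine ⟨fun i => (hasSum_norm_inner_sq b (v i)).summable, ?_⟩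
  simpa only [(hasSum_norm_inner_sq b _).tsum_eq] using hv

/-- `T = ∑ᵢ |vᵢ⟩⟨wᵢ|`, a weakly convergent sum over square-summable families. -/
structure IsRankOneSum (v w : ι → H) (T : H →L[ℂ] H) : Prop where
  summable_left : Summable fun i => ‖v i‖ ^ 2
  summable_right : Summable fun i => ‖w i‖ ^ 2
  hasSum_inner : ∀ x y, HasSum (fun i => ⟪x, v i⟫_ℂ * ⟪w i, y⟫_ℂ) ⟪x, T y⟫_ℂ

namespace IsRankOneSum

variable {v w : ι → H} {T : H →L[ℂ] H}

/-- Absolute convergence over `ι × κ`, from `|ab| ≤ |a|² + |b|²`. Summing over `κ` first gives `∑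
⟨wᵢ, vᵢ⟩`, over `ι` first the diagonal sum of `T`; so the trace is computed without reference to a
basis. -/
theorem summable_prod (h : IsRankOneSum v w T) (b : HilbertBasis κ ℂ H) :
    Summable fun p : ι × κ => ⟪b p.2, v p.1⟫_ℂ * ⟪w p.1, b p.2⟫_ℂ := by
  refine Summable.of_norm_bounded
    ((summable_prod_norm_inner_sq b h.summable_left).add
      (summable_prod_norm_inner_sq b h.summable_right)) fun p => ?_
  rw [norm_mul, norm_inner_symm (w p.1)]
  nlinarith [sq_nonneg (‖⟪b p.2, v p.1⟫_ℂ‖ - ‖⟪b p.2, w p.1⟫_ℂ‖),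
    sq_nonneg (‖⟪b p.2, v p.1⟫_ℂ‖), sq_nonneg (‖⟪b p.2, w p.1⟫_ℂ‖)]

theorem hasSum_inner_swap (h : IsRankOneSum v w T) (b : HilbertBasis κ ℂ H) :
    HasSum (fun i => ⟪w i, v i⟫_ℂ)
      (∑' p : ι × κ, ⟪b p.2, v p.1⟫_ℂ * ⟪w p.1, b p.2⟫_ℂ) := by
  refine (h.summable_prod b).hasSum.prod_fiberwise fun i => ?_
  simpa only [mul_comm] using b.hasSum_inner_mul_inner (w i) (v i)

theorem hasSum_diag (h : IsRankOneSum v w T) (b : HilbertBasis κ ℂ H) :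
    HasSum (fun k => ⟪b k, T (b k)⟫_ℂ)
      (∑' p : ι × κ, ⟪b p.2, v p.1⟫_ℂ * ⟪w p.1, b p.2⟫_ℂ) := by
  have h1 := (Equiv.prodComm κ ι).hasSum_iff.2 (h.summable_prod b).hasSum
  exact h1.prod_fiberwise fun k => h.hasSum_inner (b k) (b k)

theorem summable_diag (h : IsRankOneSum v w T) :
    Summable fun i => ⟪stdBasis H i, T (stdBasis H i)⟫_ℂ :=
  (h.hasSum_diag (stdBasis H)).summable

theorem hasSum_trace (h : IsRankOneSum v w T) :
    HasSum (fun i => ⟪w i, v i⟫_ℂ) (trace T) := by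
  rw [trace, (h.hasSum_diag (stdBasis H)).tsum_eq]
  exact h.hasSum_inner_swap (stdBasis H)

theorem summable_norm_sq_map {K : Type*} [NormedAddCommGroup K] [InnerProductSpace ℂ K]
    (A : H →L[ℂ] K) (hv : Summable fun i => ‖v i‖ ^ 2) :
    Summable fun i => ‖A (v i)‖ ^ 2 := by
  refine Summable.of_nonneg_of_le (fun _ => sq_nonneg _) (fun i => ?_) (hv.mul_left (‖A‖ ^ 2))
  rw [← mul_pow]
  gcongr
  exact A.le_opNorm _

theorem comp_comp (h : IsRankOneSum v w T) (A B : H →L[ℂ] H) :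
    IsRankOneSum (fun i => A (v i)) (fun i => B.adjoint (w i)) (A ∘L T ∘L B) where
  summable_left := summable_norm_sq_map A h.summable_left
  summable_right := summable_norm_sq_map B.adjoint h.summable_right
  hasSum_inner x y := by
    simpa only [ContinuousLinearMap.adjoint_inner_left, ContinuousLinearMap.coe_comp,
      Function.comp_apply] using h.hasSum_inner (A.adjoint x) (B y)

theorem comp_right (h : IsRankOneSum v w T) (B : H →L[ℂ] H) :
    IsRankOneSum v (fun i => B.adjoint (w i)) (T ∘L B) := by
  simpa using h.comp_comp (ContinuousLinearMap.id ℂ H) B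

theorem hasSum_trace_comp_right (h : IsRankOneSum v w T) (B : H →L[ℂ] H) :
    HasSum (fun i => ⟪w i, B (v i)⟫_ℂ) (trace (T ∘L B)) := by
  simpa only [ContinuousLinearMap.adjoint_inner_left] using (h.comp_right B).hasSum_trace

theorem nonneg (h : IsRankOneSum v v T) : 0 ≤ T := by
  refine nonneg_iff_inner.2 fun x => (h.hasSum_inner x x).nonneg fun i => ?_
  rw [← inner_conj_symm, RCLike.conj_mul]
  positivity

theorem isPosTraceClass (h : IsRankOneSum v v T) : IsPosTraceClass T :=
  ⟨h.nonneg, h.summable_diag⟩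

end IsRankOneSum

theorem exists_isRankOneSum {v : ι → H} (hv : Summable fun i => ‖v i‖ ^ 2) :
    ∃ T : H →L[ℂ] H, IsRankOneSum v v T := by
  have hs : Summable fun i => InnerProductSpace.rankOne ℂ (v i) (v i) := by
    refine Summable.of_norm ?_
    simpa only [InnerProductSpace.norm_rankOne, ← sq] using hv
  refine ⟨∑' i, InnerProductSpace.rankOne ℂ (v i) (v i), hv, hv, fun x y => ?_⟩
  have h1 := (innerSL ℂ x).hasSum ((ContinuousLinearMap.apply ℂ H y).hasSum hs.hasSum)
  simpa [inner_smul_right, mul_comm] using h1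

theorem IsPosTraceClass.isRankOneSum {ρ : H →L[ℂ] H} (h : IsPosTraceClass ρ) :
    IsRankOneSum (fun i => CFC.sqrt ρ (stdBasis H i)) (fun i => CFC.sqrt ρ (stdBasis H i)) ρ := by
  have hs : Summable fun i => ‖CFC.sqrt ρ (stdBasis H i)‖ ^ 2 := by
    rw [← Complex.summable_ofReal]
    convert h.2 using 2 with i
    rw [← sqrt_apply_sqrt_apply h.1, ← sqrt_isSymmetric, inner_self_eq_norm_sq_to_K]
    norm_cast
  refine ⟨hs, hs, fun x y => ?_⟩
  rw [← sqrt_apply_sqrt_apply h.1, ← sqrt_isSymmetric]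
  simpa only [sqrt_isSymmetric] using
    (stdBasis H).hasSum_inner_mul_inner (CFC.sqrt ρ x) (CFC.sqrt ρ y)

/-- Induction over the trace-class operators. -/
theorem traceClass_induction {p : traceClass H → Prop}
    (pos : ∀ ρ : traceClass H, IsPosTraceClass (ρ : H →L[ℂ] H) → p ρ)
    (add : ∀ ρ σ, p ρ → p σ → p (ρ + σ)) (smul : ∀ (c : ℂ) ρ, p ρ → p (c • ρ))
    (ρ : traceClass H) : p ρ := by
  obtain ⟨ρ, hρ⟩ := ρ
  induction hρ using Submodule.span_induction with
  | mem ρ h => exact pos ⟨ρ, _⟩ h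
  | zero =>
    -- Zero is a scalar multiple of the positive operator `0`, so no separate hypothesis is needed.
    have h0 := smul 0 _ (pos 0 ⟨le_rfl, by simp⟩)
    rw [zero_smul] at h0
    exact h0
  | add ρ σ hρ hσ h1 h2 => exact add ⟨ρ, hρ⟩ ⟨σ, hσ⟩ h1 h2
  | smul c ρ hρ h => exact smul c ⟨ρ, hρ⟩ h

theorem summable_diag_comp_comp (ρ : traceClass H) (A B : H →L[ℂ] H) :
    Summable fun i => ⟪stdBasis H i, (A ∘L (ρ : H →L[ℂ] H) ∘L B) (stdBasis H i)⟫_ℂ := by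
  induction ρ using traceClass_induction with
  | pos ρ h => exact (h.isRankOneSum.comp_comp A B).summable_diag
  | add ρ σ h1 h2 => simpa [inner_add_right] using h1.add h2
  | smul c ρ h => simpa [inner_smul_right] using h.mul_left c

/-- The functional `ρ ↦ Tr(A ρ B)` on the trace-class operators. -/
def traceConj (A B : H →L[ℂ] H) : traceClass H →ₗ[ℂ] ℂ where
  toFun ρ := trace (A ∘L (ρ : H →L[ℂ] H) ∘L B)
  map_add' ρ σ := by
    simp only [trace]
    rw [← (summable_diag_comp_comp ρ A B).tsum_add (summable_diag_comp_comp σ A B)]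
    simp
  map_smul' c ρ := by
    simp only [trace, RingHom.id_apply, smul_eq_mul]
    rw [← tsum_mul_left]
    simp

/-- The functional `ρ ↦ Tr(ρ A)` on the trace-class operators. -/
def traceMul (A : H →L[ℂ] H) : traceClass H →ₗ[ℂ] ℂ := traceConj 1 A

theorem traceMul_apply (A : H →L[ℂ] H) (ρ : traceClass H) :
    traceMul A ρ = trace ((ρ : H →L[ℂ] H) ∘L A) := rfl

theorem traceMul_one (ρ : traceClass H) : traceMul 1 ρ = trace (ρ : H →L[ℂ] H) := rfl

/-- Cyclicity of the trace: for `ρ = ∑ |vᵢ⟩⟨vᵢ|` both sides equal `∑ ⟨vᵢ, B A vᵢ⟩`. -/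
theorem traceMul_eq_traceConj (A B : H →L[ℂ] H) : traceMul (B ∘L A) = traceConj A B := by
  ext ρ
  induction ρ using traceClass_induction with
  | pos ρ h =>
    refine (h.isRankOneSum.hasSum_trace_comp_right _).unique ?_
    have h1 := (h.isRankOneSum.comp_comp A B).hasSum_trace
    simp only [ContinuousLinearMap.adjoint_inner_left] at h1
    exact h1
  | add ρ σ h1 h2 => rw [map_add, map_add, h1, h2]
  | smul c ρ h => rw [map_smul, map_smul, h]

theorem trace_comp_eq_traceMul (A : H →L[ℂ] H) (ρ : traceClass H) :
    trace (A ∘L (ρ : H →L[ℂ] H)) = traceMul A ρ :=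
  (LinearMap.congr_fun (traceMul_eq_traceConj A 1) ρ).symm

theorem summable_diag (ρ : traceClass H) :
    Summable fun i => ⟪stdBasis H i, (ρ : H →L[ℂ] H) (stdBasis H i)⟫_ℂ := 
  summable_diag_comp_comp ρ 1 1

theorem isPosTraceClass_of_nonneg {ρ : traceClass H} (h : 0 ≤ (ρ : H →L[ℂ] H)) :
    IsPosTraceClass (ρ : H →L[ℂ] H) := ⟨h, summable_diag ρ⟩

theorem traceMul_add (A B : H →L[ℂ] H) (ρ : traceClass H) :
    traceMul (A + B) ρ = traceMul A ρ + traceMul B ρ := by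
  have h := Summable.tsum_add (summable_diag_comp_comp ρ A 1) (summable_diag_comp_comp ρ B 1)
  simp only [← trace_comp_eq_traceMul]
  refine Eq.trans ?_ h
  simp [trace]

theorem traceMul_smul (c : ℂ) (A : H →L[ℂ] H) (ρ : traceClass H) :
    traceMul (c • A) ρ = c * traceMul A ρ := by
  simp only [← trace_comp_eq_traceMul, trace, ← tsum_mul_left]
  simp

theorem traceMul_nonneg {A : H →L[ℂ] H} (hA : 0 ≤ A) {ρ : traceClass H}
    (hρ : 0 ≤ (ρ : H →L[ℂ] H)) : 0 ≤ traceMul A ρ :=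
  ((isPosTraceClass_of_nonneg hρ).isRankOneSum.hasSum_trace_comp_right A).nonneg
    fun _ => nonneg_iff_inner.1 hA _

theorem isRankOneSum_rankOne (x : H) :
    IsRankOneSum (fun _ : Unit => x) (fun _ => x) (InnerProductSpace.rankOne ℂ x x) where
  summable_left := (hasSum_unique _).summable
  summable_right := (hasSum_unique _).summable
  hasSum_inner y z := by
    convert hasSum_unique (fun _ : Unit => ⟪y, x⟫_ℂ * ⟪x, z⟫_ℂ) using 1
    simp [mul_comm]

theorem rankOne_self_mem_traceClass (x : H) :
    InnerProductSpace.rankOne ℂ x x ∈ traceClass H :=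
  Submodule.subset_span (isRankOneSum_rankOne x).isPosTraceClass

/-- The trace-class operator `|x⟩⟨x|`. -/
def pure (x : H) : traceClass H := ⟨_, rankOne_self_mem_traceClass x⟩

theorem traceMul_pure (A : H →L[ℂ] H) (x : H) : traceMul A (pure x) = ⟪x, A x⟫_ℂ :=
  ((isRankOneSum_rankOne x).hasSum_trace_comp_right A).unique (hasSum_unique _)

end TraceTheory

/-! ### Operator sums, their columns and their duals -/

section Kraus

variable {H K : Type*} [NormedAddCommGroup H] [InnerProductSpace ℂ H] [CompleteSpace H]
  [NormedAddCommGroup K] [InnerProductSpace ℂ K] [CompleteSpace K] {ι : Type*}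

/-- The Hilbert space `K ⊕ K ⊕ ⋯`. -/
abbrev Ampl (K : Type*) [NormedAddCommGroup K] : Type _ := lp (fun _ : ℕ => K) 2

/-- The operator `A ⊕ A ⊕ ⋯`. -/
def ampl (A : K →L[ℂ] K) : Ampl K →L[ℂ] Ampl K :=
  lp.mapCLM 2 (fun _ => A) (norm_nonneg A) fun _ => le_rfl

theorem ampl_apply (A : K →L[ℂ] K) (g : Ampl K) (i : ℕ) : ampl A g i = A (g i) := rfl

/-- The `i`-th coordinate of a vector in `K ⊕ K ⊕ ⋯`. -/
def coord (i : ℕ) : Ampl K →L[ℂ] K := lp.evalCLM ℂ (fun _ : ℕ => K) 2 i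

theorem ampl_adjoint (A : K →L[ℂ] K) : (ampl A).adjoint = ampl A.adjoint := by
  symm
  rw [ContinuousLinearMap.eq_adjoint_iff]
  intro f g
  refine (lp.hasSum_inner _ _).unique ?_
  simpa only [ampl_apply, ContinuousLinearMap.adjoint_inner_left] using lp.hasSum_inner f (ampl A g)

/-- Packaging the family as one bounded operator turns infinite operator sums into compositions with
`V` and `ampl`. -/
theorem exists_column {E : ℕ → H →L[ℂ] K} {C : ℝ} (hC : 0 ≤ C)
    (hE : ∀ x (s : Finset ℕ), ∑ i ∈ s, ‖E i x‖ ^ 2 ≤ (C * ‖x‖) ^ 2) :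
    ∃ V : H →L[ℂ] Ampl K, ∀ x i, V x i = E i x := by
  have hmem : ∀ x, Memℓp (fun i => E i x) 2 := fun x =>
    memℓp_gen' (C := (C * ‖x‖) ^ 2) fun s => by simpa using hE x s
  let V : H →ₗ[ℂ] Ampl K :=
    { toFun x := ⟨fun i => E i x, hmem x⟩
      map_add' x y := by ext i; exact map_add (E i) x y
      map_smul' c x := by ext i; exact map_smul (E i) c x }
  refine ⟨V.mkContinuous C fun x => ?_, fun x i => rfl⟩
  refine lp.norm_le_of_forall_sum_le (by norm_num) (by positivity) fun s => ?_
  simpa [V] using hE x s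

section Column

variable {E : ℕ → H →L[ℂ] K} {V : H →L[ℂ] Ampl K}

theorem hasSum_inner_column
    (hV : ∀ x i, V x i = E i x) (x y : H) : HasSum (fun i => ⟪E i x, E i y⟫_ℂ) ⟪V x, V y⟫_ℂ := by
  simpa only [hV] using lp.hasSum_inner (V x) (V y)

theorem hasSum_inner_ampl_column
    (hV : ∀ x i, V x i = E i x) (A : K →L[ℂ] K) (x y : H) :
    HasSum (fun i => ⟪E i x, A (E i y)⟫_ℂ) ⟪x, (V.adjoint ∘L ampl A ∘L V) y⟫_ℂ := by
  simp only [ContinuousLinearMap.coe_comp, Function.comp_apply,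
    ContinuousLinearMap.adjoint_inner_right]
  simpa only [hV, ampl_apply] using lp.hasSum_inner (V x) (ampl A (V y))

theorem hasSum_norm_sq_column
    (hV : ∀ x i, V x i = E i x) (x : H) : HasSum (fun i => ‖E i x‖ ^ 2) (‖V x‖ ^ 2) := by
  have h := hasSum_inner_column hV x x
  simp only [inner_self_eq_norm_sq_to_K] at h
  exact_mod_cast h

theorem summable_prod_column
    (hV : ∀ x i, V x i = E i x) {v : ι → H} (hv : Summable fun i => ‖v i‖ ^ 2) :
    Summable fun p : ι × ℕ => ‖E p.2 (v p.1)‖ ^ 2 := by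
  rw [summable_prod_of_nonneg (fun _ => sq_nonneg _)]
  refine ⟨fun i => (hasSum_norm_sq_column hV (v i)).summable, ?_⟩
  simpa only [(hasSum_norm_sq_column hV _).tsum_eq] using IsRankOneSum.summable_norm_sq_map V hv

/-- If `ρ = ∑ |vᵢ⟩⟨vᵢ|`, the operator sum is the rank-one sum of all `E k (v i)`; summing it over
`i` first recovers the terms `Eₖ ρ Eₖ†`. -/
theorem hasSum_operatorSum {v : ι → H} {ρ : H →L[ℂ] H} (h : IsRankOneSum v v ρ)
    {T : K →L[ℂ] K} (hT : IsRankOneSum (fun p : ι × ℕ => E p.2 (v p.1))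
      (fun p : ι × ℕ => E p.2 (v p.1)) T) (x y : K) :
    HasSum (fun k => ⟪x, (E k ∘L ρ ∘L (E k).adjoint) y⟫_ℂ) ⟪x, T y⟫_ℂ := by
  refine ((Equiv.prodComm ℕ ι).hasSum_iff.2 (hT.hasSum_inner x y)).prod_fiberwise fun k => ?_
  simpa only [ContinuousLinearMap.coe_comp, Function.comp_apply, Equiv.prodComm_apply,
    Prod.swap, ContinuousLinearMap.adjoint_inner_left, ContinuousLinearMap.adjoint_inner_right]
    using h.hasSum_inner ((E k).adjoint x) ((E k).adjoint y)

theorem exists_operatorSum_apply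
    (hV : ∀ x i, V x i = E i x) (ρ : traceClass H) :
    ∃ T : traceClass K, ∀ x y, HasSum (fun k =>
      ⟪x, (E k ∘L (ρ : H →L[ℂ] H) ∘L (E k).adjoint) y⟫_ℂ) ⟪x, (T : K →L[ℂ] K) y⟫_ℂ := by
  induction ρ using traceClass_induction with
  | pos ρ h =>
    obtain ⟨T, hT⟩ := exists_isRankOneSum
      (summable_prod_column hV h.isRankOneSum.summable_left)
    exact ⟨⟨T, Submodule.subset_span hT.isPosTraceClass⟩,
      hasSum_operatorSum h.isRankOneSum hT⟩
  | add ρ σ h1 h2 =>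
    obtain ⟨T, hT⟩ := h1
    obtain ⟨S, hS⟩ := h2
    exact ⟨T + S, fun x y => by simpa [inner_add_right] using (hT x y).add (hS x y)⟩
  | smul c ρ h =>
    obtain ⟨T, hT⟩ := h
    exact ⟨c • T, fun x y => by simpa [inner_smul_right] using (hT x y).mul_left c⟩

/-- The images are chosen one by one; linearity is automatic because a weak limit determines its
operator. -/
theorem exists_isOperatorSum
    (hV : ∀ x i, V x i = E i x) : ∃ Φ : traceClass H →ₗ[ℂ] traceClass K, IsOperatorSum Φ E := by
  choose f hf using exists_operatorSum_apply hV
  have huniq : ∀ (S T : traceClass K),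
      (∀ x y, ⟪x, (S : K →L[ℂ] K) y⟫_ℂ = ⟪x, (T : K →L[ℂ] K) y⟫_ℂ) → S = T := fun S T h =>
    Subtype.ext (ContinuousLinearMap.ext fun y => ext_inner_left ℂ fun x => h x y)
  refine ⟨{ toFun := f, map_add' := fun ρ σ => ?_, map_smul' := fun c ρ => ?_ }, hf⟩
  · refine huniq _ _ fun x y => (hf (ρ + σ) x y).unique ?_
    simpa [inner_add_right] using (hf ρ x y).add (hf σ x y)
  · refine huniq _ _ fun x y => (hf (c • ρ) x y).unique ?_
    simpa [inner_smul_right] using (hf ρ x y).mul_left c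

theorem IsOperatorSum.isRankOneSum
    (hV : ∀ x i, V x i = E i x) {Φ : traceClass H →ₗ[ℂ] traceClass K}
    (hΦ : IsOperatorSum Φ E) {ρ : traceClass H} {v : ι → H}
    (h : IsRankOneSum v v (ρ : H →L[ℂ] H)) :
    IsRankOneSum (fun p : ι × ℕ => E p.2 (v p.1)) (fun p : ι × ℕ => E p.2 (v p.1))
      (Φ ρ : K →L[ℂ] K) := by
  obtain ⟨T, hT⟩ := exists_isRankOneSum (summable_prod_column hV h.summable_left)
  have : (Φ ρ : K →L[ℂ] K) = T := ContinuousLinearMap.ext fun y => ext_inner_left ℂ fun x =>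
    (hΦ ρ x y).unique (hasSum_operatorSum h hT x y)
  exact this ▸ hT

/-- The dual of a map with operator-sum form `∑ₖ Eₖ ρ Eₖ†` is `A ↦ ∑ₖ Eₖ† A Eₖ`. -/
theorem IsOperatorSum.isDualAt
    (hV : ∀ x i, V x i = E i x) {Φ : traceClass H →ₗ[ℂ] traceClass K}
    (hΦ : IsOperatorSum Φ E) (A : K →L[ℂ] K) :
    IsDualAt Φ A (V.adjoint ∘L ampl A ∘L V) := by
  intro ρ
  rw [← traceMul_apply, ← traceMul_apply]
  induction ρ using traceClass_induction with
  | pos ρ h =>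
    have h0 := h.isRankOneSum
    generalize (fun i => CFC.sqrt (ρ : H →L[ℂ] H) (stdBasis H i)) = v at h0
    have h1 := (hΦ.isRankOneSum hV h0).hasSum_trace_comp_right A
    have h2 : HasSum (fun i => ⟪v i, (V.adjoint ∘L ampl A ∘L V) (v i)⟫_ℂ) _ :=
      h1.prod_fiberwise fun i => hasSum_inner_ampl_column hV A (v i) (v i)
    exact h2.unique (h0.hasSum_trace_comp_right _)
  | add ρ σ h1 h2 => simp only [map_add, h1, h2]
  | smul c ρ h => simp only [map_smul, h]

end Column

theorem IsOperatorSum.isCompletelyPositive {Φ : traceClass H →ₗ[ℂ] traceClass K}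
    {E : ℕ → H →L[ℂ] K} (hΦ : IsOperatorSum Φ E) : IsCompletelyPositive Φ := by
  intro n M hM v
  refine (hasSum_sum fun i _ => hasSum_sum fun j _ => hΦ (M i j) (v i) (v j)).nonneg fun k => ?_
  simpa only [ContinuousLinearMap.coe_comp, Function.comp_apply,
    ContinuousLinearMap.adjoint_inner_left] using hM fun i => (E k).adjoint (v i)

theorem IsDualAt.unique {Φ : traceClass H →ₗ[ℂ] traceClass K} {A : K →L[ℂ] K}
    {B C : H →L[ℂ] H} (hB : IsDualAt Φ A B) (hC : IsDualAt Φ A C) : B = C := by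
  have h : ∀ x, ⟪x, B x⟫_ℂ = ⟪x, C x⟫_ℂ := fun x => by
    rw [← traceMul_pure, ← traceMul_pure, traceMul_apply, traceMul_apply]
    exact (hB _).symm.trans (hC _)
  have h2 : (B : H →ₗ[ℂ] H) = C := by
    rw [← ext_inner_map]
    intro x
    rw [← inner_conj_symm, ← inner_conj_symm ((C : H →ₗ[ℂ] H) x)]
    exact congrArg _ (h x)
  exact ContinuousLinearMap.coe_injective h2

theorem IsDualAt.dual_eq {Φ : traceClass H →ₗ[ℂ] traceClass K} {A : K →L[ℂ] K}
    {B : H →L[ℂ] H} (hB : IsDualAt Φ A B) : dual Φ A = B := by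
  have h : ∃ B, IsDualAt Φ A B := ⟨B, hB⟩
  rw [dual, dif_pos h]
  exact (Classical.choose_spec h).unique hB

/-- Tonelli for `‖⟨bₖ, vᵢ⟩‖²`: finite trace forces square-summability, so a merely weak rank-one
expansion is an `IsRankOneSum`. It is applied to `Φ(|x⟩⟨x|) = ∑ |Eₖx⟩⟨Eₖx|`. -/
theorem summable_norm_sq_of_summable_diag {v : ι → H} {T : H →L[ℂ] H}
    (h : ∀ x y, HasSum (fun i => ⟪x, v i⟫_ℂ * ⟪v i, y⟫_ℂ) ⟪x, T y⟫_ℂ)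
    (hT : Summable fun k => ⟪stdBasis H k, T (stdBasis H k)⟫_ℂ) :
    Summable fun i => ‖v i‖ ^ 2 := by
  set b := stdBasis H
  have h1 : ∀ k, HasSum (fun i => ‖⟪b k, v i⟫_ℂ‖ ^ 2) (⟪b k, T (b k)⟫_ℂ).re := fun k => by
    have h2 := Complex.hasSum_re (h (b k) (b k))
    refine h2.congr_fun fun i => ?_
    rw [← inner_conj_symm (v i), RCLike.mul_conj]
    norm_cast
  have h3 : Summable fun p : _ × ι => ‖⟪b p.1, v p.2⟫_ℂ‖ ^ 2 := by
    rw [summable_prod_of_nonneg (fun _ => sq_nonneg _)]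
    refine ⟨fun k => (h1 k).summable, ?_⟩
    simp only [(h1 _).tsum_eq]
    exact (Complex.hasSum_re hT.hasSum).summable
  have h4 := ((Equiv.prodComm ι _).summable_iff.2 h3).prod
  refine h4.congr fun i => (hasSum_norm_inner_sq b (v i)).tsum_eq

/-- The elements of a channel satisfy `∑ₖ Eₖ† Eₖ = 1`. -/
theorem IsChannel.hasSum_norm_sq {Φ : traceClass H →ₗ[ℂ] traceClass K} (h : IsChannel Φ)
    {E : ℕ → H →L[ℂ] K} (hE : IsOperatorSum Φ E) (x : H) :
    HasSum (fun k => ‖E k x‖ ^ 2) (‖x‖ ^ 2) := by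
  have h1 : ∀ a b, HasSum (fun k => ⟪a, E k x⟫_ℂ * ⟪E k x, b⟫_ℂ)
      ⟪a, (Φ (pure x) : K →L[ℂ] K) b⟫_ℂ := fun a b => by
    have h2 := hE (pure x) a b
    simpa [pure, ContinuousLinearMap.adjoint_inner_right, mul_comm] using h2
  have h2 := summable_norm_sq_of_summable_diag h1 (summable_diag _)
  have h3 := IsRankOneSum.hasSum_trace ⟨h2, h2, h1⟩
  rw [h.tracePreserving, ← traceMul_one, traceMul_pure] at h3
  simp only [inner_self_eq_norm_sq_to_K, one_apply_eq_self] at h3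
  exact_mod_cast h3

theorem IsChannel.exists_column {Φ : traceClass H →ₗ[ℂ] traceClass K} (h : IsChannel Φ)
    {E : ℕ → H →L[ℂ] K} (hE : IsOperatorSum Φ E) :
    ∃ V : H →L[ℂ] Ampl K, (∀ x i, V x i = E i x) ∧ ∀ x y, ⟪V x, V y⟫_ℂ = ⟪x, y⟫_ℂ := by
  obtain ⟨V, hV⟩ := QECAlg.exists_column zero_le_one fun x s => by
    simpa using sum_le_hasSum s (fun _ _ => sq_nonneg _) (h.hasSum_norm_sq hE x)
  refine ⟨V, hV, ?_⟩
  have hn : ∀ x, ‖V x‖ = ‖x‖ := fun x =>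
    (sq_eq_sq₀ (norm_nonneg _) (norm_nonneg _)).1
      ((hasSum_norm_sq_column hV x).unique (h.hasSum_norm_sq hE x))
  exact (LinearMap.norm_map_iff_inner_map_map V).1 hn

end Kraus

/-! ### Polar decomposition and intertwining -/

section Polar

variable {K G : Type*} [NormedAddCommGroup K] [InnerProductSpace ℂ K] [CompleteSpace K]
  [NormedAddCommGroup G] [InnerProductSpace ℂ G] [CompleteSpace G]

theorem adjoint_sqrt (T : K →L[ℂ] K) : (CFC.sqrt T).adjoint = CFC.sqrt T :=
  ((ContinuousLinearMap.nonneg_iff_isPositive _).1 (CFC.sqrt_nonneg T)).isSelfAdjoint.adjoint_eq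

theorem adjoint_comp_self_nonneg (W : K →L[ℂ] G) : 0 ≤ W.adjoint ∘L W := by
  refine nonneg_iff_inner.2 fun x => ?_
  rw [ContinuousLinearMap.coe_comp, Function.comp_apply, ContinuousLinearMap.adjoint_inner_right,
    inner_self_eq_norm_sq_to_K]
  positivity

theorem norm_sqrt_adjoint_comp_self (W : K →L[ℂ] G) (x : K) :
    ‖CFC.sqrt (W.adjoint ∘L W) x‖ = ‖W x‖ := by
  have h : ⟪CFC.sqrt (W.adjoint ∘L W) x, CFC.sqrt (W.adjoint ∘L W) x⟫_ℂ = ⟪W x, W x⟫_ℂ := by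
    rw [sqrt_isSymmetric, sqrt_apply_sqrt_apply (adjoint_comp_self_nonneg W),
      ContinuousLinearMap.coe_comp, Function.comp_apply, ContinuousLinearMap.adjoint_inner_right]
  rw [inner_self_eq_norm_sq_to_K, inner_self_eq_norm_sq_to_K] at h
  exact (sq_eq_sq₀ (norm_nonneg _) (norm_nonneg _)).1 (by exact_mod_cast h)

/-- The polar decomposition `W = U |W|`. -/
theorem exists_polar (W : K →L[ℂ] G) (N : Submodule ℂ K) [CompleteSpace N]
    (hN : N = (LinearMap.ker (CFC.sqrt (W.adjoint ∘L W) : K →L[ℂ] K).toLinearMap)ᗮ) :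
    ∃ U : K →L[ℂ] G, U ∘L CFC.sqrt (W.adjoint ∘L W) = W ∧
      U.adjoint ∘L U = N.starProjection ∧ ∀ g, U.adjoint g ∈ N := by
  set s := CFC.sqrt (W.adjoint ∘L W) with hs
  have hcl : N = (LinearMap.range s.toLinearMap).topologicalClosure := by
    rw [hN, ContinuousLinearMap.orthogonal_ker, adjoint_sqrt]
  have hmem : ∀ x, s x ∈ N := fun x => by
    rw [hcl]
    exact Submodule.le_topologicalClosure _ ⟨x, rfl⟩
  let e : K →ₗ[ℂ] N := s.toLinearMap.codRestrict N hmem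
  have hd : DenseRange e := by
    rw [DenseRange, Subtype.dense_iff]
    intro x hx
    have hx' : x ∈ closure (Set.range s) := by
      have : x ∈ (LinearMap.range s.toLinearMap).topologicalClosure := hcl ▸ hx
      exact this
    convert hx'
    ext y
    constructor
    · rintro ⟨_, ⟨z, rfl⟩, rfl⟩
      exact ⟨z, rfl⟩
    · rintro ⟨z, rfl⟩
      exact ⟨e z, ⟨z, rfl⟩, rfl⟩
  have hb : ∀ x, ‖W x‖ = ‖e x‖ := fun x => (norm_sqrt_adjoint_comp_self W x).symm
  -- The map `|W| x ↦ W x` is isometric on the range of `|W|`, which is dense in `N`; it extends to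
  -- `N`, and the projection onto `N` extends it by zero.
  let U₀ : N →L[ℂ] G := W.toLinearMap.extendOfNorm e
  have hU₀ : ∀ x, U₀ (e x) = W x := fun x =>
    LinearMap.extendOfNorm_eq hd ⟨1, fun x => by simpa using (hb x).le⟩ x
  have hiso : ∀ n, ‖U₀ n‖ = ‖n‖ := fun n =>
    hd.induction_on n (isClosed_eq (by fun_prop) (by fun_prop)) fun x => by rw [hU₀, hb]
  have hinner := (LinearMap.norm_map_iff_inner_map_map U₀).1 hiso
  have hUU : (U₀ ∘L N.orthogonalProjectionOnto).adjoint ∘L (U₀ ∘L N.orthogonalProjectionOnto) =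
      N.starProjection := by
    refine ContinuousLinearMap.ext fun y => ext_inner_left ℂ fun x => ?_
    rw [ContinuousLinearMap.coe_comp, Function.comp_apply, ContinuousLinearMap.adjoint_inner_right]
    simp only [ContinuousLinearMap.coe_comp, Function.comp_apply]
    rw [hinner]
    change ⟪N.starProjection x, N.starProjection y⟫_ℂ = _
    rw [Submodule.inner_starProjection_left_eq_right,
      Submodule.starProjection_eq_self_iff.2 (Submodule.starProjection_apply_mem _ _)]
  refine ⟨U₀ ∘L N.orthogonalProjectionOnto, ?_, hUU, fun g => ?_⟩
  · ext x
    have : N.orthogonalProjectionOnto (s x) = e x :=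
      N.orthogonalProjectionOnto_mem_subspace_eq_self (e x)
    simp only [ContinuousLinearMap.coe_comp, Function.comp_apply]
    rw [this, hU₀]
  · refine (Submodule.orthogonal_orthogonal N).le fun u hu => ?_
    rw [ContinuousLinearMap.adjoint_inner_right, ContinuousLinearMap.coe_comp, Function.comp_apply,
      N.orthogonalProjectionOnto_apply_of_mem_orthogonal hu, map_zero, inner_zero_left]

/-- If `a` commutes with `W W†`, then `U† a U` intertwines `W†` and `a`, where `W = U |W|`. -/
theorem polar_intertwine {W U : K →L[ℂ] G} {N : Submodule ℂ K}
    (hN : N = (LinearMap.ker (CFC.sqrt (W.adjoint ∘L W) : K →L[ℂ] K).toLinearMap)ᗮ)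
    (hU : U ∘L CFC.sqrt (W.adjoint ∘L W) = W) (hUN : ∀ g, U.adjoint g ∈ N)
    {a : G →L[ℂ] G} (ha : Commute a (W ∘L W.adjoint)) :
    (U.adjoint ∘L a ∘L U) ∘L W.adjoint = W.adjoint ∘L a := by
  have hT := adjoint_comp_self_nonneg W
  -- `W†aW` commutes with `W†W` because `a` commutes with `WW†`; by functional calculus it commutes
  -- with `|W|`.
  have hcomm : Commute (CFC.sqrt (W.adjoint ∘L W)) (W.adjoint ∘L a ∘L W) := by
    refine Commute.cfcₙ_nnreal ?_ NNReal.sqrt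
    change (W.adjoint ∘L W) ∘L (W.adjoint ∘L a ∘L W) = (W.adjoint ∘L a ∘L W) ∘L (W.adjoint ∘L W)
    have ha' : a ∘L (W ∘L W.adjoint) = (W ∘L W.adjoint) ∘L a := ha
    ext x
    exact congrArg W.adjoint (DFunLike.congr_fun ha' (W x)).symm
  have hss := sqrt_apply_sqrt_apply hT
  set s := CFC.sqrt (W.adjoint ∘L W) with hs
  have hsU : ∀ g, s (U.adjoint g) = W.adjoint g := fun g => by
    rw [← hU, ContinuousLinearMap.adjoint_comp, adjoint_sqrt]; rfl
  have hUs : ∀ x, U (s x) = W x := DFunLike.congr_fun hU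
  have hsN : ∀ x, s x ∈ N := fun x => by
    rw [hN, ContinuousLinearMap.orthogonal_ker, adjoint_sqrt]
    exact Submodule.le_topologicalClosure _ ⟨x, rfl⟩
  have hinj : ∀ x ∈ N, ∀ y ∈ N, s x = s y → x = y := fun x hx y hy hxy => by
    have h1 : x - y ∈ LinearMap.ker s.toLinearMap := by simpa [sub_eq_zero] using hxy
    have h2 : x - y ∈ (LinearMap.ker s.toLinearMap)ᗮ := hN ▸ N.sub_mem hx hy
    exact sub_eq_zero.1 (inner_self_eq_zero.1 (h2 _ h1))
  have hB : ∀ x, s (U.adjoint (a (U (s x)))) = W.adjoint (a (W x)) := fun x => by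
    rw [hsU, hUs]
  -- With `B = U†aU` one has `sBs = W†aW`, so `s(sBs) = (sBs)s`. Cancelling the left `s`, which is
  -- injective on `N`, gives `sBs = Bss`.
  have hBs : ∀ x, s (U.adjoint (a (U (s x)))) = U.adjoint (a (U (s (s x)))) := fun x => by
    refine hinj _ (hsN _) _ (hUN _) ?_
    rw [hB, hB]
    exact DFunLike.congr_fun hcomm.eq x
  have hWa : ∀ g, W.adjoint (W (W.adjoint (a g))) = W.adjoint (a (W (W.adjoint g))) := fun g =>
    congrArg W.adjoint (DFunLike.congr_fun ha.eq g).symm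
  have hWN : ∀ g, W.adjoint g ∈ N := fun g => hsU g ▸ hsN _
  ext g
  change U.adjoint (a (U (W.adjoint g))) = W.adjoint (a g)
  refine hinj _ (hUN _) _ (hWN _) ?_
  rw [← hsU g, hBs]
  refine hinj _ (hUN _) _ (hsN _) ?_
  rw [hss (W.adjoint (a g))]
  change _ = W.adjoint (W (W.adjoint (a g)))
  rw [hWa, hB, hsU]

end Polar

/-! ### The recovery map as an operator sum -/

section Recovery

variable {H K : Type*} [NormedAddCommGroup H] [InnerProductSpace ℂ H] [CompleteSpace H]
  [NormedAddCommGroup K] [InnerProductSpace ℂ K] [CompleteSpace K]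

/-- `√λᵢ` for the weights `λᵢ = 2⁻ⁱ`. -/
def rootWeight (i : ℕ) : ℝ := √((1 / 2) ^ i)

theorem rootWeight_sq (i : ℕ) : rootWeight i ^ 2 = (1 / 2) ^ i :=
  Real.sq_sqrt (by positivity)

theorem rootWeight_mul_self (i : ℕ) : (rootWeight i : ℂ) * rootWeight i = weight i := by
  rw [← sq, weight, ← Complex.ofReal_pow, rootWeight_sq]
  push_cast
  rfl

theorem rootWeight_ne_zero (i : ℕ) : (rootWeight i : ℂ) ≠ 0 := by
  rw [Complex.ofReal_ne_zero, rootWeight]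
  positivity

theorem norm_adjoint_apply_le {E : H →L[ℂ] K} (hE : ∀ x, ‖E x‖ ≤ ‖x‖) (y : K) :
    ‖E.adjoint y‖ ≤ ‖y‖ := by
  refine (E.adjoint.le_of_opNorm_le ?_ y).trans (one_mul _).le
  rw [LinearIsometryEquiv.norm_map]
  exact E.opNorm_le_bound zero_le_one fun x => by simpa using hE x

theorem exists_weightedColumn {E : ℕ → H →L[ℂ] K} (hE : ∀ i x, ‖E i x‖ ≤ ‖x‖) :
    ∃ W : K →L[ℂ] Ampl H, ∀ y i, W y i = ((rootWeight i : ℂ) • (E i).adjoint) y := by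
  -- The weights sum to `2`, and `2 ≤ 2²`.
  refine exists_column zero_le_two fun y s => ?_
  calc ∑ i ∈ s, ‖((rootWeight i : ℂ) • (E i).adjoint) y‖ ^ 2
      ≤ ∑ i ∈ s, (1 / 2 : ℝ) ^ i * ‖y‖ ^ 2 := by
        refine Finset.sum_le_sum fun i _ => ?_
        rw [smul_apply, norm_smul, mul_pow, Complex.norm_real, Real.norm_eq_abs,
          sq_abs, rootWeight_sq]
        gcongr
        exact norm_adjoint_apply_le (hE i) y
    _ ≤ 2 * ‖y‖ ^ 2 := by
        rw [← Finset.sum_mul]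
        gcongr
        exact sum_le_hasSum s (fun _ _ => by positivity) hasSum_geometric_two
    _ ≤ (2 * ‖y‖) ^ 2 := by nlinarith [sq_nonneg ‖y‖]

/-- Operators on `H ⊕ H ⊕ ⋯` are determined by their matrix entries: coordinates separate outputs,
and passing to adjoints does the same for inputs. -/
theorem coord_ext {X Y : Ampl H →L[ℂ] Ampl H}
    (h : ∀ i j, coord i ∘L X ∘L (coord j).adjoint = coord i ∘L Y ∘L (coord j).adjoint) :
    X = Y := by
  have h1 : ∀ j, X ∘L (coord j).adjoint = Y ∘L (coord j).adjoint := fun j => by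
    ext x i
    exact DFunLike.congr_fun (h i j) x
  have h2 : X.adjoint = Y.adjoint := by
    ext g j
    have := congrArg ContinuousLinearMap.adjoint (h1 j)
    rw [ContinuousLinearMap.adjoint_comp, ContinuousLinearMap.adjoint_comp,
      ContinuousLinearMap.adjoint_adjoint] at this
    exact DFunLike.congr_fun this g
  exact ContinuousLinearMap.adjoint.injective h2

theorem ampl_comp_adjoint_coord (A : H →L[ℂ] H) (j : ℕ) :
    ampl A ∘L (coord j).adjoint = (coord j).adjoint ∘L A := by
  apply ContinuousLinearMap.adjoint.injective
  rw [ContinuousLinearMap.adjoint_comp, ContinuousLinearMap.adjoint_comp,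
    ContinuousLinearMap.adjoint_adjoint, ampl_adjoint]
  rfl

theorem ampl_one : ampl (1 : H →L[ℂ] H) = 1 := rfl

section WeightedColumn

variable {E : ℕ → H →L[ℂ] K} {W : K →L[ℂ] Ampl H}

theorem coord_comp_weightedColumn
    (hW : ∀ y i, W y i = ((rootWeight i : ℂ) • (E i).adjoint) y) (i : ℕ) :
    coord i ∘L W = (rootWeight i : ℂ) • (E i).adjoint := by
  ext y
  exact hW y i

theorem weightedColumn_adjoint_coord
    (hW : ∀ y i, W y i = ((rootWeight i : ℂ) • (E i).adjoint) y) (i : ℕ) :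
    W.adjoint ∘L (coord i).adjoint = (rootWeight i : ℂ) • E i := by
  rw [← ContinuousLinearMap.adjoint_comp, coord_comp_weightedColumn hW, map_smulₛₗ,
    ContinuousLinearMap.adjoint_adjoint, Complex.conj_ofReal]

theorem regularized_one
    (hW : ∀ y i, W y i = ((rootWeight i : ℂ) • (E i).adjoint) y)
    (hE : ∀ i x, ‖E i x‖ ≤ ‖x‖) : regularized E 1 = W.adjoint ∘L W := by
  have hs : Summable fun i => weight i • (E i ∘L (1 : H →L[ℂ] H) ∘L (E i).adjoint) := by
    refine Summable.of_norm_bounded summable_geometric_two fun i => ?_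
    refine ContinuousLinearMap.opNorm_le_bound _ (by positivity) fun y => ?_
    rw [smul_apply, norm_smul, weight]
    have h := (hE i ((E i).adjoint y)).trans (norm_adjoint_apply_le (hE i) y)
    calc _ ≤ ‖(1 / 2 : ℂ) ^ i‖ * ‖y‖ := by gcongr; exact h
      _ = _ := by simp
  refine ContinuousLinearMap.ext fun y => ext_inner_left ℂ fun x => ?_
  have h1 := (innerSL ℂ x).hasSum ((ContinuousLinearMap.apply ℂ K y).hasSum hs.hasSum)
  have h2 := hasSum_inner_column hW x y
  rw [← ContinuousLinearMap.adjoint_inner_right] at h2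
  refine HasSum.unique h1 (h2.congr_fun fun i => ?_)
  simp only [innerSL_apply_apply, ContinuousLinearMap.apply_apply, smul_apply,
    inner_smul_left, inner_smul_right, Complex.conj_ofReal, ContinuousLinearMap.coe_comp,
    Function.comp_apply, one_apply_eq_self, ContinuousLinearMap.adjoint_inner_left]
  rw [← mul_assoc, rootWeight_mul_self]

/-- `|W|` and `W` have the same kernel. As no weight vanishes, it is the intersection of the kernels
of the `Eᵢ†`, the orthogonal complement of all the ranges. -/
theorem rangeSpan_eq_orthogonal_ker
    (hW : ∀ y i, W y i = ((rootWeight i : ℂ) • (E i).adjoint) y) :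
    rangeSpan E = (LinearMap.ker (CFC.sqrt (W.adjoint ∘L W) : K →L[ℂ] K).toLinearMap)ᗮ := by
  rw [rangeSpan, ← Submodule.orthogonal_orthogonal_eq_closure]
  congr 1
  ext y
  have h1 : y ∈ LinearMap.ker (CFC.sqrt (W.adjoint ∘L W) : K →L[ℂ] K).toLinearMap ↔
      ∀ i, (E i).adjoint y = 0 := by
    rw [LinearMap.mem_ker, ContinuousLinearMap.coe_coe, ← norm_eq_zero,
      norm_sqrt_adjoint_comp_self, norm_eq_zero]
    constructor
    · intro h i
      have := hW y i
      rw [h] at this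
      exact (smul_eq_zero.1 this.symm).resolve_left (rootWeight_ne_zero i)
    · intro h
      ext i
      rw [hW y i, smul_apply, h i, smul_zero]
      rfl
  rw [h1, ← Submodule.iInf_orthogonal, Submodule.mem_iInf]
  refine forall_congr' fun i => ?_
  rw [ContinuousLinearMap.orthogonal_range]
  rfl

/-- The `(i, j)` block of `WW†` is `√λᵢ √λⱼ Eᵢ†Eⱼ`, and `ampl A` is block diagonal, so commutation
can be checked block by block. -/
theorem commute_ampl
    (hW : ∀ y i, W y i = ((rootWeight i : ℂ) • (E i).adjoint) y)
    {A : H →L[ℂ] H} (hA : A ∈ correctableAlgebra E) :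
    Commute (ampl A) (W ∘L W.adjoint) := by
  rw [mem_correctableAlgebra] at hA
  refine coord_ext fun i j => ?_
  have h1 : coord i ∘L (W ∘L W.adjoint) ∘L (coord j).adjoint =
      ((rootWeight i : ℂ) * rootWeight j) • ((E i).adjoint ∘L E j) := by
    rw [ContinuousLinearMap.comp_assoc, weightedColumn_adjoint_coord hW,
      ← ContinuousLinearMap.comp_assoc, coord_comp_weightedColumn hW]
    ext x
    simp only [mul_smul, ContinuousLinearMap.coe_comp, Function.comp_apply, smul_apply, map_smul]
    rw [smul_comm]
  calc coord i ∘L (ampl A ∘L (W ∘L W.adjoint)) ∘L (coord j).adjoint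
      = A ∘L (coord i ∘L (W ∘L W.adjoint) ∘L (coord j).adjoint) := rfl
    _ = (coord i ∘L (W ∘L W.adjoint) ∘L (coord j).adjoint) ∘L A := by
        rw [h1]
        exact (hA i j).smul_right _
    _ = coord i ∘L ((W ∘L W.adjoint) ∘L ampl A) ∘L (coord j).adjoint := by
        simp only [ContinuousLinearMap.comp_assoc, ampl_comp_adjoint_coord]

end WeightedColumn

theorem mem_rangeSpan (E : ℕ → H →L[ℂ] K) (i : ℕ) (x : H) : E i x ∈ rangeSpan E :=
  Submodule.le_topologicalClosure _ (Submodule.mem_iSup_of_mem i ⟨x, rfl⟩)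

/-- If `w ⊥ ker T^{1/2}` and `T^{1/2} w = y`, then `T^{-1/2} y = w`. -/
theorem invSqrt_apply_eq {T : K →L[ℂ] K} {w : K}
    (hw : w ∈ (LinearMap.ker (CFC.sqrt T : K →L[ℂ] K).toLinearMap)ᗮ)
    {y : (invSqrt T).domain} (hy : CFC.sqrt T w = y) : invSqrt T y = w := by
  have hker : ((CFC.sqrt T : K →L[ℂ] K).toLinearMap.toPMap
      (LinearMap.ker (CFC.sqrt T : K →L[ℂ] K).toLinearMap)ᗮ).toFun.ker = ⊥ := by
    rw [LinearMap.ker_eq_bot']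
    rintro ⟨x, hx⟩ h
    exact Subtype.ext (inner_self_eq_zero.1 (hx x h))
  exact LinearPMap.inverse_apply_eq hker (x := ⟨w, hw⟩) hy

theorem mem_domain_invSqrt {T : K →L[ℂ] K} {w : K}
    (hw : w ∈ (LinearMap.ker (CFC.sqrt T : K →L[ℂ] K).toLinearMap)ᗮ) :
    CFC.sqrt T w ∈ (invSqrt T).domain := by
  rw [invSqrt, LinearPMap.inverse_domain]
  exact ⟨⟨w, hw⟩, rfl⟩

/-- The recovery map is the operator sum of the components of a partial isometry
`U : K → H ⊕ H ⊕ ⋯` with initial space the closed span of the ranges of the `Eᵢ`. -/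
theorem exists_recovery_isometry {E : ℕ → H →L[ℂ] K} (hE : ∀ i x, ‖E i x‖ ≤ ‖x‖) :
    ∃ U : K →L[ℂ] Ampl H,
      (∀ R, IsRecoveryMap E R ↔ IsOperatorSum R fun i => coord i ∘L U) ∧
      U.adjoint ∘L U = (rangeSpan E).starProjection ∧
      ∀ A ∈ correctableAlgebra E, ∀ j, (U.adjoint ∘L ampl A ∘L U) ∘L E j = E j ∘L A := by
  obtain ⟨W, hW⟩ := exists_weightedColumn hE
  have hN := rangeSpan_eq_orthogonal_ker hW
  obtain ⟨U, hU, hUU, hUN⟩ := exists_polar W (rangeSpan E) hN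
  refine ⟨U, fun R => ?_, hUU, fun A hA j => ?_⟩
  · have hT := regularized_one hW hE
    -- The adjoint of `U|W| = W` is `|W|U† = W†`, whose `i`-th component is `√λᵢ Eᵢ`. This exhibits
    -- the preimage of `Eᵢ x` that `S` selects.
    have hsqrt : ∀ i x, CFC.sqrt (regularized E 1)
        ((rootWeight i : ℂ)⁻¹ • U.adjoint ((coord i).adjoint x)) = E i x := fun i x => by
      have h1 : CFC.sqrt (regularized E 1) (U.adjoint ((coord i).adjoint x)) =
          (rootWeight i : ℂ) • E i x := by
        have h2 := congrArg ContinuousLinearMap.adjoint hU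
        rw [ContinuousLinearMap.adjoint_comp, adjoint_sqrt, ← hT] at h2
        exact (DFunLike.congr_fun h2 _).trans
          (DFunLike.congr_fun (weightedColumn_adjoint_coord hW i) x)
      rw [map_smul, h1, inv_smul_smul₀ (rootWeight_ne_zero i)]
    have hmem : ∀ i x, (rootWeight i : ℂ)⁻¹ • U.adjoint ((coord i).adjoint x) ∈
        (LinearMap.ker (CFC.sqrt (regularized E 1) : K →L[ℂ] K).toLinearMap)ᗮ := fun i x => by
      rw [hT, ← hN]
      exact Submodule.smul_mem _ _ (hUN _)
    have hdom : ∀ i x, E i x ∈ (invSqrt (regularized E 1)).domain := fun i x => by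
      rw [← hsqrt]
      exact mem_domain_invSqrt (hmem i x)
    have hval : ∀ i x, invSqrt (regularized E 1) ⟨E i x, hdom i x⟩ =
        (rootWeight i : ℂ)⁻¹ • U.adjoint ((coord i).adjoint x) := fun i x =>
      invSqrt_apply_eq (hmem i x) (hsqrt i x)
    -- The two factors `λᵢ^{-1/2}` coming from `S` cancel the weight `λᵢ`.
    have hterm : ∀ (ρ : traceClass K) x y i, weight i *
          ⟪invSqrt (regularized E 1) ⟨E i x, hdom i x⟩,
            (ρ : K →L[ℂ] K) (invSqrt (regularized E 1) ⟨E i y, hdom i y⟩)⟫_ℂ =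
        ⟪x, ((coord i ∘L U) ∘L (ρ : K →L[ℂ] K) ∘L (coord i ∘L U).adjoint) y⟫_ℂ := by
      intro ρ x y i
      have h0 := rootWeight_ne_zero i
      rw [hval, hval, map_smul, inner_smul_left, inner_smul_right, ← rootWeight_mul_self,
        map_inv₀, Complex.conj_ofReal, ContinuousLinearMap.adjoint_comp]
      simp only [ContinuousLinearMap.coe_comp, Function.comp_apply]
      rw [ContinuousLinearMap.adjoint_inner_left U, ContinuousLinearMap.adjoint_inner_left]
      field_simp
    constructor
    · rintro ⟨_, h⟩ ρ x y
      simpa only [hterm] using h ρ x y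
    · intro h
      refine ⟨hdom, fun ρ x y => ?_⟩
      simpa only [hterm] using h ρ x y
  · have h := polar_intertwine hN hU hUN (commute_ampl hW hA)
    have h1 : (U.adjoint ∘L ampl A ∘L U) ∘L (W.adjoint ∘L (coord j).adjoint) =
        (W.adjoint ∘L (coord j).adjoint) ∘L A := by
      rw [← ContinuousLinearMap.comp_assoc, h, ContinuousLinearMap.comp_assoc,
        ampl_comp_adjoint_coord, ContinuousLinearMap.comp_assoc]
    rw [weightedColumn_adjoint_coord hW, ContinuousLinearMap.comp_smul,
      ContinuousLinearMap.smul_comp] at h1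
    exact smul_right_injective _ (rootWeight_ne_zero j) h1

end Recovery

/-! ### Duals of arbitrary channels and correctable sharp effects -/

section Duality

variable {H K : Type*} [NormedAddCommGroup H] [InnerProductSpace ℂ H] [CompleteSpace H]
  [NormedAddCommGroup K] [InnerProductSpace ℂ K] [CompleteSpace K]

theorem rankOne_polarization (x y : H) :
    (4 : ℂ) • InnerProductSpace.rankOne ℂ y x =
      InnerProductSpace.rankOne ℂ (y + x) (y + x) - InnerProductSpace.rankOne ℂ (y - x) (y - x) +
      Complex.I • InnerProductSpace.rankOne ℂ (y + Complex.I • x) (y + Complex.I • x) -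
      Complex.I • InnerProductSpace.rankOne ℂ (y - Complex.I • x) (y - Complex.I • x) := by
  simp only [map_add, map_sub, map_smul, map_smulₛₗ, add_apply, sub_apply, smul_apply,
    Complex.conj_I, smul_add, smul_sub, smul_smul, neg_smul, smul_neg]
  simp only [Complex.I_mul_I, neg_mul, neg_neg, one_smul, neg_smul]
  module

theorem rankOne_mem_traceClass (x y : H) : InnerProductSpace.rankOne ℂ y x ∈ traceClass H := by
  have h : (4 : ℂ) • InnerProductSpace.rankOne ℂ y x ∈ traceClass H := by
    rw [rankOne_polarization]
    have hm := rankOne_self_mem_traceClass (H := H)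
    exact sub_mem (add_mem (sub_mem (hm _) (hm _)) (Submodule.smul_mem _ _ (hm _)))
      (Submodule.smul_mem _ _ (hm _))
  exact (Submodule.smul_mem_iff _ (by norm_num)).1 h

/-- The trace-class operator `|y⟩⟨x|`, as a sesquilinear map. -/
def outer : H →ₗ⋆[ℂ] H →ₗ[ℂ] traceClass H :=
  LinearMap.mk₂'ₛₗ (starRingEnd ℂ) (RingHom.id ℂ)
    (fun x y => ⟨InnerProductSpace.rankOne ℂ y x, rankOne_mem_traceClass x y⟩)
    (fun _ _ _ => Subtype.ext (by simp)) (fun _ _ _ => Subtype.ext (by simp))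
    (fun _ _ _ => Subtype.ext (by simp)) (fun _ _ _ => Subtype.ext (by simp))

theorem outer_polarization (x y : H) :
    (4 : ℂ) • outer x y = pure (y + x) - pure (y - x) +
      Complex.I • pure (y + Complex.I • x) - Complex.I • pure (y - Complex.I • x) :=
  Subtype.ext (rankOne_polarization x y)

theorem pure_nonneg (x : H) : 0 ≤ (pure x : H →L[ℂ] H) := (isRankOneSum_rankOne x).nonneg

theorem IsCompletelyPositive.map_nonneg {Φ : traceClass H →ₗ[ℂ] traceClass K}
    (hΦ : IsCompletelyPositive Φ) {ρ : traceClass H} (hρ : 0 ≤ (ρ : H →L[ℂ] H)) :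
    0 ≤ (Φ ρ : K →L[ℂ] K) := by
  refine nonneg_iff_inner.2 fun x => ?_
  have h := hΦ 1 (fun _ _ => ρ) (fun v => by simpa using nonneg_iff_inner.1 hρ (v 0)) fun _ => x
  simpa using h

theorem IsEffect.traceMul_le {A : H →L[ℂ] H} (hA : IsEffect A) {ρ : traceClass H}
    (hρ : 0 ≤ (ρ : H →L[ℂ] H)) : traceMul A ρ ≤ trace (ρ : H →L[ℂ] H) := by
  have h := traceMul_nonneg (sub_nonneg.2 hA.2) hρ
  have h1 := traceMul_add A (1 - A) ρ
  rw [add_sub_cancel, traceMul_one] at h1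
  rw [h1]
  exact le_add_of_nonneg_right h

theorem norm_le_norm_of_nonneg_of_le {a b : ℂ} (ha : 0 ≤ a) (hab : a ≤ b) : ‖a‖ ≤ ‖b‖ := by
  have h : (RCLike.ofReal ‖a‖ : ℂ) ≤ RCLike.ofReal ‖b‖ := by
    rwa [RCLike.norm_of_nonneg' ha, RCLike.norm_of_nonneg' (ha.trans hab)]
  exact RCLike.ofReal_le_ofReal.1 h

/-- The functional `ρ ↦ Tr(Φ(ρ) A)` is bounded on positive operators. -/
theorem IsChannel.norm_traceMul_le {Φ : traceClass H →ₗ[ℂ] traceClass K} (hΦ : IsChannel Φ)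
    {A : K →L[ℂ] K} (hA : IsEffect A) {ρ : traceClass H} (hρ : 0 ≤ (ρ : H →L[ℂ] H)) :
    ‖traceMul A (Φ ρ)‖ ≤ ‖trace (ρ : H →L[ℂ] H)‖ := by
  have h := hΦ.completelyPositive.map_nonneg hρ
  refine norm_le_norm_of_nonneg_of_le (traceMul_nonneg hA.1 h) ?_
  rw [← hΦ.tracePreserving]
  exact hA.traceMul_le h

/-- For unit vectors, polarization gives four terms of size at most `‖y ± z‖² ≤ 4`, divided by `4`;
homogeneity does the rest. The constant is not sharp, but only boundedness matters. -/
theorem IsChannel.norm_traceMul_outer_le {Φ : traceClass H →ₗ[ℂ] traceClass K}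
    (hΦ : IsChannel Φ) {A : K →L[ℂ] K} (hA : IsEffect A) (x y : H) :
    ‖traceMul A (Φ (outer x y))‖ ≤ 4 * ‖x‖ * ‖y‖ := by
  have hpure : ∀ z : H, ‖traceMul A (Φ (pure z))‖ ≤ ‖z‖ ^ 2 := fun z => by
    refine (hΦ.norm_traceMul_le hA (pure_nonneg z)).trans_eq ?_
    rw [← traceMul_one, traceMul_pure, one_apply_eq_self, inner_self_eq_norm_sq_to_K]
    simp
  have hunit : ∀ x y : H, ‖x‖ = 1 → ‖y‖ = 1 → ‖traceMul A (Φ (outer x y))‖ ≤ 4 := by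
    intro x y hx hy
    have hz : ∀ z : H, ‖z‖ = 1 → ‖traceMul A (Φ (pure (y + z)))‖ ≤ 4 ∧
        ‖traceMul A (Φ (pure (y - z)))‖ ≤ 4 := fun z hz => by
      have h1 := norm_add_le y z
      have h2 := norm_sub_le y z
      have h3 := norm_nonneg (y + z)
      have h4 := norm_nonneg (y - z)
      exact ⟨(hpure _).trans (by nlinarith), (hpure _).trans (by nlinarith)⟩
    have h := congrArg (fun ρ => ‖traceMul A (Φ ρ)‖) (outer_polarization x y)
    simp only [map_add, map_sub, map_smul, norm_smul] at h
    have hI : ‖Complex.I • x‖ = 1 := by rw [norm_smul, Complex.norm_I, hx, one_mul]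
    have h1 := hz x hx
    have h2 := hz _ hI
    have h5 := norm_sub_le (traceMul A (Φ (pure (y + x))) - traceMul A (Φ (pure (y - x))) +
      Complex.I • traceMul A (Φ (pure (y + Complex.I • x))))
      (Complex.I • traceMul A (Φ (pure (y - Complex.I • x))))
    have h6 := norm_add_le (traceMul A (Φ (pure (y + x))) - traceMul A (Φ (pure (y - x))))
      (Complex.I • traceMul A (Φ (pure (y + Complex.I • x))))
    have h7 := norm_sub_le (traceMul A (Φ (pure (y + x)))) (traceMul A (Φ (pure (y - x))))
    rw [norm_smul, Complex.norm_I, one_mul] at h5 h6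
    have h8 : ‖(4 : ℂ)‖ = 4 := by simp
    rw [h8] at h
    linarith [h1.1, h1.2, h2.1, h2.2]
  rcases eq_or_ne x 0 with rfl | hx
  · simp
  rcases eq_or_ne y 0 with rfl | hy
  · simp
  have h1 := hunit ((‖x‖ : ℂ)⁻¹ • x) ((‖y‖ : ℂ)⁻¹ • y) (by simp [norm_smul, hx])
    (by simp [norm_smul, hy])
  simp only [map_smulₛₗ, LinearMap.smul_apply, norm_smul] at h1
  have hx0 := norm_pos_iff.2 hx
  have hy0 := norm_pos_iff.2 hy
  simp only [RingHom.id_apply, map_inv₀, Complex.conj_ofReal, norm_inv, Complex.norm_real,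
    norm_norm] at h1
  rw [inv_mul_le_iff₀ hy0, inv_mul_le_iff₀ hx0] at h1
  linarith

/-- The partial sums of `ρ = ∑ᵢ |vᵢ⟩⟨vᵢ|` are dominated by `ρ`. -/
theorem IsRankOneSum.sub_sum_pure_nonneg {ι : Type*} {v : ι → H} {ρ : traceClass H}
    (h : IsRankOneSum v v (ρ : H →L[ℂ] H)) (s : Finset ι) :
    0 ≤ ((ρ - ∑ i ∈ s, pure (v i) : traceClass H) : H →L[ℂ] H) := by
  refine nonneg_iff_inner.2 fun x => ?_
  have h1 : ⟪x, ((ρ - ∑ i ∈ s, pure (v i) : traceClass H) : H →L[ℂ] H) x⟫_ℂ =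
      ⟪x, (ρ : H →L[ℂ] H) x⟫_ℂ - ∑ i ∈ s, ⟪x, v i⟫_ℂ * ⟪v i, x⟫_ℂ := by
    simp [pure, mul_comm]
  rw [h1, sub_nonneg]
  refine sum_le_hasSum s (fun i _ => ?_) (h.hasSum_inner x x)
  rw [← inner_conj_symm, RCLike.conj_mul]
  positivity

theorem IsChannel.exists_isDualAt {Φ : traceClass H →ₗ[ℂ] traceClass K} (hΦ : IsChannel Φ)
    {A : K →L[ℂ] K} (hA : IsEffect A) : ∃ B, IsDualAt Φ A B := by
  -- A correcting channel comes without an operator sum, so its dual is built from the bounded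
  -- sesquilinear form `(x, y) ↦ Tr(Φ(|y⟩⟨x|) A)`.
  let f : H →ₗ⋆[ℂ] H →ₗ[ℂ] ℂ := outer.compr₂ₛₗ (traceMul A ∘ₗ Φ)
  let F : H →L⋆[ℂ] H →L[ℂ] ℂ := f.mkContinuous₂ 4 fun x y => hΦ.norm_traceMul_outer_le hA x y
  let B : H →L[ℂ] H := (InnerProductSpace.continuousLinearMapOfBilin F).adjoint
  have hB : ∀ x, ⟪x, B x⟫_ℂ = traceMul A (Φ (pure x)) := fun x => by
    rw [ContinuousLinearMap.adjoint_inner_right,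
      InnerProductSpace.continuousLinearMapOfBilin_apply]
    rfl
  refine ⟨B, fun ρ => ?_⟩
  rw [← traceMul_apply, ← traceMul_apply]
  induction ρ using traceClass_induction with
  | pos ρ h =>
    have h0 := h.isRankOneSum
    generalize (fun i => CFC.sqrt (ρ : H →L[ℂ] H) (stdBasis H i)) = v at h0
    refine HasSum.unique ?_ (h0.hasSum_trace_comp_right B)
    rw [HasSum, tendsto_iff_norm_sub_tendsto_zero]
    have htr := h0.hasSum_trace
    rw [HasSum, tendsto_iff_norm_sub_tendsto_zero] at htr
    refine squeeze_zero (fun _ => norm_nonneg _) (fun s => ?_) htr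
    -- The error of a partial sum is `Tr(Φ(τ) A)` for the positive remainder `τ` of `ρ`, hence is
    -- bounded by `Tr τ`, which tends to zero.
    have h1 := hΦ.norm_traceMul_le hA (h0.sub_sum_pure_nonneg s)
    rw [← traceMul_one] at h1
    simp only [map_sub, map_sum, traceMul_pure, ← hB] at h1
    rw [norm_sub_rev, norm_sub_rev _ (trace _)]
    exact h1
  | add ρ σ h1 h2 => simp only [map_add, h1, h2]
  | smul c ρ h => simp only [map_smul, h]

/-- The dual of a channel maps effects to effects. -/
theorem IsChannel.isEffect_of_isDualAt {Φ : traceClass H →ₗ[ℂ] traceClass K} (hΦ : IsChannel Φ)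
    {A : K →L[ℂ] K} (hA : IsEffect A) {B : H →L[ℂ] H} (hB : IsDualAt Φ A B) : IsEffect B := by
  have h : ∀ x, ⟪x, B x⟫_ℂ = traceMul A (Φ (pure x)) := fun x => by
    rw [← traceMul_pure, traceMul_apply, traceMul_apply]
    exact (hB _).symm
  have hpos : ∀ x, 0 ≤ (Φ (pure x) : K →L[ℂ] K) := fun x =>
    hΦ.completelyPositive.map_nonneg (pure_nonneg x)
  refine ⟨nonneg_iff_inner.2 fun x => h x ▸ traceMul_nonneg hA.1 (hpos x), ?_⟩
  rw [← sub_nonneg]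
  refine nonneg_iff_inner.2 fun x => ?_
  rw [sub_apply, inner_sub_right, sub_nonneg, h]
  refine (hA.traceMul_le (hpos x)).trans_eq ?_
  rw [hΦ.tracePreserving, ← traceMul_one, traceMul_pure]

theorem apply_eq_zero_of_inner_eq_zero {T : H →L[ℂ] H} (hT : 0 ≤ T) {x : H}
    (hx : ⟪x, T x⟫_ℂ = 0) : T x = 0 := by
  rw [← sqrt_apply_sqrt_apply hT, ← sqrt_isSymmetric, inner_self_eq_zero] at hx
  rw [← sqrt_apply_sqrt_apply hT, hx, map_zero]

/-- A correctable sharp effect commutes with all `Eᵢ† Eⱼ`. -/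
theorem mem_correctableAlgebra_of_isCorrectable {Φ : traceClass H →ₗ[ℂ] traceClass K}
    (hΦ : IsChannel Φ) {E : ℕ → H →L[ℂ] K} (hE : IsOperatorSum Φ E) {P : H →L[ℂ] H}
    (hP : IsSharpEffect P) (hc : IsCorrectable Φ P) : P ∈ correctableAlgebra E := by
  obtain ⟨R, hR, hRP⟩ := hc
  obtain ⟨B, hB⟩ := hR.exists_isDualAt hP.1
  have hBe := hR.isEffect_of_isDualAt hP.1 hB
  obtain ⟨V, hV, hVi⟩ := hΦ.exists_column hE
  rw [IsCorrectedBy, hB.dual_eq, (hE.isDualAt hV B).dual_eq] at hRP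
  have hsum : ∀ x, HasSum (fun i => ⟪E i x, B (E i x)⟫_ℂ) ⟪x, P x⟫_ℂ := fun x => by
    have := hasSum_inner_ampl_column hV B x x
    rwa [← hRP] at this
  -- A vanishing sum of nonnegative terms has vanishing terms; `hone` uses the same argument with `1
  -- - B`.
  have hzero : ∀ x, P x = 0 → ∀ i, B (E i x) = 0 := fun x hx i => by
    have h := hsum x
    rw [hx, inner_zero_right, hasSum_zero_iff_of_nonneg
      fun i => nonneg_iff_inner.1 hBe.1 (E i x)] at h
    exact apply_eq_zero_of_inner_eq_zero hBe.1 (congrFun h i)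
  have hone : ∀ x, P x = x → ∀ i, B (E i x) = E i x := fun x hx i => by
    have h := (hasSum_inner_column hV x x).sub (hsum x)
    simp only [hVi, hx, sub_self, ← inner_sub_right] at h
    have hnn := sub_nonneg.2 hBe.2
    have h' : HasSum (fun i => ⟪E i x, (1 - B) (E i x)⟫_ℂ) 0 := h
    rw [hasSum_zero_iff_of_nonneg fun i => nonneg_iff_inner.1 hnn (E i x)] at h'
    have := apply_eq_zero_of_inner_eq_zero hnn (congrFun h' i)
    exact (sub_eq_zero.1 this).symm
  have hPP : ∀ x, P (P x) = P x := DFunLike.congr_fun hP.2.isIdempotentElem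
  -- Split `x` into `P x` and `x - P x`.
  have hBE : ∀ i, B ∘L E i = E i ∘L P := fun i => by
    ext x
    have h1 := hone (P x) (hPP x) i
    have h2 := hzero (x - P x) (by rw [map_sub, hPP, sub_self]) i
    rw [map_sub, map_sub, sub_eq_zero] at h2
    exact h2.trans h1
  have hBa : B.adjoint = B :=
    ((ContinuousLinearMap.nonneg_iff_isPositive _).1 hBe.1).isSelfAdjoint.adjoint_eq
  have hPa : P.adjoint = P := hP.2.isSelfAdjoint.adjoint_eq
  have hEB : ∀ i, (E i).adjoint ∘L B = P ∘L (E i).adjoint := fun i => by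
    have := congrArg ContinuousLinearMap.adjoint (hBE i)
    rwa [ContinuousLinearMap.adjoint_comp, ContinuousLinearMap.adjoint_comp, hBa, hPa] at this
  rw [mem_correctableAlgebra]
  intro i j
  change P ∘L ((E i).adjoint ∘L E j) = ((E i).adjoint ∘L E j) ∘L P
  rw [← ContinuousLinearMap.comp_assoc, ← hEB, ContinuousLinearMap.comp_assoc, hBE,
    ContinuousLinearMap.comp_assoc]

end Duality

/-! ### Spanning by effects and completion to a channel -/

section Main

variable {H K : Type*} [NormedAddCommGroup H] [InnerProductSpace ℂ H] [CompleteSpace H]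
  [NormedAddCommGroup K] [InnerProductSpace ℂ K] [CompleteSpace K]

/-- A von Neumann algebra is spanned by its effects. -/
theorem span_effects (𝒜 : VonNeumannAlgebra H) :
    (Submodule.span ℂ {A | IsEffect A ∧ A ∈ 𝒜} : Set (H →L[ℂ] H)) = 𝒜 := by
  apply Set.Subset.antisymm
  · intro A hA
    induction hA using Submodule.span_induction with
    | mem A h => exact h.2
    | zero => exact zero_mem 𝒜
    | add A B _ _ h1 h2 => exact add_mem (S := VonNeumannAlgebra H) h1 h2
    | smul c A _ h => exact 𝒜.toStarSubalgebra.smul_mem h c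
  · have hone : (1 : H →L[ℂ] H) ∈ Submodule.span ℂ {A | IsEffect A ∧ A ∈ 𝒜} :=
      Submodule.subset_span ⟨⟨zero_le_one, le_rfl⟩, one_mem 𝒜⟩
    have hsa : ∀ A ∈ 𝒜, IsSelfAdjoint A → A ∈ Submodule.span ℂ {A | IsEffect A ∧ A ∈ 𝒜} := by
      intro A hA hs
      rcases eq_or_ne A 0 with rfl | h0
      · exact zero_mem _
      have hn : 0 < ‖A‖ := norm_pos_iff.2 h0
      have hc : (0 : ℂ) ≤ ((2 * ‖A‖)⁻¹ : ℝ) := by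
        rw [Complex.zero_le_real]
        positivity
      have hc' : (((2 * ‖A‖)⁻¹ : ℝ) : ℂ) ≠ 0 := by
        rw [Complex.ofReal_ne_zero]
        positivity
      have hsm : ∀ T : H →L[ℂ] H, 0 ≤ T → 0 ≤ (((2 * ‖A‖)⁻¹ : ℝ) : ℂ) • T := fun T hT => by
        rw [ContinuousLinearMap.nonneg_iff_isPositive] at hT ⊢
        exact hT.smul_of_nonneg hc
      have hmap : algebraMap ℝ (H →L[ℂ] H) ‖A‖ = (‖A‖ : ℂ) • 1 := by
        rw [Algebra.algebraMap_eq_smul_one]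
        ext x
        simp
      have h1 : 0 ≤ A + (‖A‖ : ℂ) • (1 : H →L[ℂ] H) := by
        have := hs.neg_algebraMap_norm_le_self
        rw [hmap] at this
        exact neg_le_iff_add_nonneg.1 this
      have h2 : 0 ≤ (‖A‖ : ℂ) • (1 : H →L[ℂ] H) - A := by
        have := hs.le_algebraMap_norm_self
        rw [hmap] at this
        exact sub_nonneg.2 this
      -- `(A + ‖A‖)/(2‖A‖)` is an effect: its complement is `(‖A‖ - A)/(2‖A‖)`.
      have h3 : (((2 * ‖A‖)⁻¹ : ℝ) : ℂ) • (A + (‖A‖ : ℂ) • (1 : H →L[ℂ] H)) ∈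
          Submodule.span ℂ {A | IsEffect A ∧ A ∈ 𝒜} := by
        refine Submodule.subset_span ⟨⟨hsm _ h1, ?_⟩, 𝒜.toStarSubalgebra.smul_mem
          (add_mem hA (𝒜.toStarSubalgebra.smul_mem (one_mem _) _)) _⟩
        rw [← sub_nonneg]
        convert hsm _ h2 using 1
        have h4 : (((2 * ‖A‖)⁻¹ : ℝ) : ℂ) * (2 * ‖A‖) = 1 := by
          rw [← Complex.ofReal_ofNat, ← Complex.ofReal_mul, ← Complex.ofReal_mul,
            inv_mul_cancel₀ (by positivity), Complex.ofReal_one]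
        rw [sub_eq_iff_eq_add, ← smul_add, add_comm A, sub_add_add_cancel, ← add_smul,
          smul_smul, ← two_mul, h4, one_smul]
      have h5 := (Submodule.smul_mem_iff _ hc').1 h3
      simpa using sub_mem h5 (Submodule.smul_mem _ (‖A‖ : ℂ) hone)
    intro A hA
    have hA' : star A ∈ 𝒜 := star_mem (s := 𝒜) hA
    have h1 := hsa (A + star A) (add_mem hA hA') (IsSelfAdjoint.add_star_self A)
    have h2 := hsa (Complex.I • (A - star A)) (𝒜.toStarSubalgebra.smul_mem (sub_mem hA hA') _) (by
      rw [IsSelfAdjoint, star_smul, star_sub, star_star, Complex.star_def, Complex.conj_I,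
        neg_smul, ← smul_neg, neg_sub])
    have h3 : A = (1 / 2 : ℂ) • (A + star A) - (Complex.I / 2) • (Complex.I • (A - star A)) := by
      rw [smul_smul, div_mul_eq_mul_div, Complex.I_mul_I]
      module
    rw [h3]
    exact sub_mem (Submodule.smul_mem _ _ h1) (Submodule.smul_mem _ _ h2)

theorem IsCompletelyPositive.add {Φ Ψ : traceClass H →ₗ[ℂ] traceClass K}
    (hΦ : IsCompletelyPositive Φ) (hΨ : IsCompletelyPositive Ψ) :
    IsCompletelyPositive (Φ + Ψ) := by
  intro n M hM v
  have h := add_nonneg (hΦ n M hM v) (hΨ n M hM v)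
  simpa [inner_add_right, Finset.sum_add_distrib] using h

/-- Measuring an effect and preparing a fixed positive operator is completely positive. -/
theorem isCompletelyPositive_traceMul_smulRight {P : H →L[ℂ] H} (hP : 0 ≤ P) {σ : traceClass K}
    (hσ : 0 ≤ (σ : K →L[ℂ] K)) : IsCompletelyPositive ((traceMul P).smulRight σ) := by
  intro n M hM v
  have h0 := (isPosTraceClass_of_nonneg hσ).isRankOneSum
  have h1 := hasSum_sum (s := Finset.univ) fun i _ => hasSum_sum (s := Finset.univ) fun j _ =>
    (h0.hasSum_inner (v i) (v j)).mul_left (traceMul P (M i j))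
  have h2 := h1.nonneg fun k => by
    -- Expanding `σ = ∑ |wₖ⟩⟨wₖ|`, the `k`-th term is `Tr(N P)`, where `N` is the block operator
    -- compressed by the scalars `⟨wₖ, vᵢ⟩`, hence positive.
    have hN : 0 ≤ ((∑ i, ∑ j, (⟪v i, CFC.sqrt (σ : K →L[ℂ] K) (stdBasis K k)⟫_ℂ *
        ⟪CFC.sqrt (σ : K →L[ℂ] K) (stdBasis K k), v j⟫_ℂ) • M i j : traceClass H) :
          H →L[ℂ] H) := by
      refine nonneg_iff_inner.2 fun x => ?_
      have h3 := hM fun i => ⟪CFC.sqrt (σ : K →L[ℂ] K) (stdBasis K k), v i⟫_ℂ • x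
      convert h3 using 1
      simp only [Submodule.coe_sum, Submodule.coe_smul, sum_apply, smul_apply, inner_sum,
        inner_smul_left, inner_smul_right, map_smul, inner_conj_symm]
      exact Finset.sum_congr rfl fun i _ => Finset.sum_congr rfl fun j _ => by ring
    have h4 := traceMul_nonneg hP hN
    simpa only [map_sum, map_smul, smul_eq_mul, mul_comm] using h4
  simpa [inner_smul_right] using h2

theorem IsChannel.norm_apply_le {Φ : traceClass H →ₗ[ℂ] traceClass K} (hΦ : IsChannel Φ)
    {E : ℕ → H →L[ℂ] K} (hE : IsOperatorSum Φ E) (i : ℕ) (x : H) : ‖E i x‖ ≤ ‖x‖ :=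
  (sq_le_sq₀ (norm_nonneg _) (norm_nonneg _)).1
    (le_hasSum (hΦ.hasSum_norm_sq hE x) i fun _ _ => sq_nonneg _)

/-- If `B Eⱼ = Eⱼ A` for all `j`, then `𝓔*(B) = A`. -/
theorem IsChannel.isDualAt_of_intertwine {Φ : traceClass H →ₗ[ℂ] traceClass K}
    (hΦ : IsChannel Φ) {E : ℕ → H →L[ℂ] K} (hE : IsOperatorSum Φ E) {A : H →L[ℂ] H}
    {B : K →L[ℂ] K} (h : ∀ j, B ∘L E j = E j ∘L A) : IsDualAt Φ B A := by
  obtain ⟨V, hV, hVi⟩ := hΦ.exists_column hE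
  have h1 : V.adjoint ∘L ampl B ∘L V = A := by
    refine ContinuousLinearMap.ext fun y => ext_inner_left ℂ fun x => ?_
    refine (hasSum_inner_ampl_column hV B x y).unique ?_
    -- As `V` is isometric, `⟨x, A y⟩ = ⟨V x, V A y⟩ = ∑ ⟨Eᵢ x, Eᵢ A y⟩`.
    rw [← hVi]
    refine (hasSum_inner_column hV x (A y)).congr_fun fun i => ?_
    exact congrArg _ (DFunLike.congr_fun (h i) y)
  exact h1 ▸ hE.isDualAt hV B

theorem IsChannel.isCorrectedBy_of_intertwine {Φ : traceClass H →ₗ[ℂ] traceClass K}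
    (hΦ : IsChannel Φ) {E : ℕ → H →L[ℂ] K} (hE : IsOperatorSum Φ E)
    {R : traceClass K →ₗ[ℂ] traceClass H} {A : H →L[ℂ] H} {B : K →L[ℂ] K}
    (hB : IsDualAt R A B) (h : ∀ j, B ∘L E j = E j ∘L A) : IsCorrectedBy Φ R A := by
  rw [IsCorrectedBy, hB.dual_eq, (hΦ.isDualAt_of_intertwine hE h).dual_eq]

theorem IsOperatorSum.unique {Φ Ψ : traceClass H →ₗ[ℂ] traceClass K} {E : ℕ → H →L[ℂ] K}
    (hΦ : IsOperatorSum Φ E) (hΨ : IsOperatorSum Ψ E) : Φ = Ψ :=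
  LinearMap.ext fun ρ => Subtype.ext <| ContinuousLinearMap.ext fun y =>
    ext_inner_left ℂ fun x => (hΦ ρ x y).unique (hΨ ρ x y)

theorem one_sub_starProjection_nonneg (N : Submodule ℂ H) [N.HasOrthogonalProjection] :
    0 ≤ 1 - N.starProjection := by
  refine nonneg_iff_inner.2 fun x => ?_
  have h : 1 - N.starProjection = Nᗮ.starProjection := by
    rw [Submodule.starProjection_orthogonal']
  rw [h]
  exact ((ContinuousLinearMap.nonneg_iff_isPositive _).1
    (IsStarProjection.nonneg isStarProjection_starProjection)).inner_nonneg_right x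

end Main

end QECAlg

end

theorem mainTheorem2 {H₁ H₂ Ω : Type*}
    [NormedAddCommGroup H₁] [InnerProductSpace ℂ H₁] [CompleteSpace H₁]
    [NormedAddCommGroup H₂] [InnerProductSpace ℂ H₂] [CompleteSpace H₂]
    [MeasurableSpace Ω]
    (𝓔 : QECAlg.traceClass H₁ →ₗ[ℂ] QECAlg.traceClass H₂) (h𝓔 : QECAlg.IsChannel 𝓔)
    (E : ℕ → H₁ →L[ℂ] H₂) (hE : QECAlg.IsOperatorSum 𝓔 E) :
    -- the effects in the algebra span it
    (Submodule.span ℂ {A | QECAlg.IsEffect A ∧ A ∈ QECAlg.correctableAlgebra E} : Set (H₁ →L[ℂ] H₁))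
        = (QECAlg.correctableAlgebra E : Set (H₁ →L[ℂ] H₁)) ∧
    -- the explicit formula defines exactly one linear map `R : B_t(H₂) → B_t(H₁)`
    (∃! R : QECAlg.traceClass H₂ →ₗ[ℂ] QECAlg.traceClass H₁, QECAlg.IsRecoveryMap E R) ∧
    (∀ R : QECAlg.traceClass H₂ →ₗ[ℂ] QECAlg.traceClass H₁, QECAlg.IsRecoveryMap E R →
      -- `R` is completely positive and preserves the trace on the closed span of the ranges
      QECAlg.IsCompletelyPositive R ∧
      (∀ ρ, QECAlg.trace (R ρ : H₁ →L[ℂ] H₁) =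
        QECAlg.trace ((QECAlg.rangeSpan E).starProjection ∘L (ρ : H₂ →L[ℂ] H₂))) ∧
      (QECAlg.rangeSpan E = ⊤ → QECAlg.IsChannel R) ∧
      -- `R` corrects all effects, and all POVMs with effects, in the algebra
      (∀ A, QECAlg.IsEffect A → A ∈ QECAlg.correctableAlgebra E → QECAlg.IsCorrectedBy 𝓔 R A) ∧
      (∀ X : QECAlg.POVM Ω H₁,
        (∀ ω, MeasurableSet ω → X.effect ω ∈ QECAlg.correctableAlgebra E) →
        ∀ ω, MeasurableSet ω → QECAlg.IsCorrectedBy 𝓔 R (X.effect ω)) ∧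
      -- completed by any state on the complement of the ranges, `R` is a channel, with the same
      -- property
      (∀ σ : QECAlg.traceClass H₁, QECAlg.IsState σ →
        ∃ R' : QECAlg.traceClass H₂ →ₗ[ℂ] QECAlg.traceClass H₁,
          (∀ ρ, R' ρ = R ρ + QECAlg.trace
            ((1 - (QECAlg.rangeSpan E).starProjection) ∘L (ρ : H₂ →L[ℂ] H₂)) • σ) ∧
          QECAlg.IsChannel R' ∧
          (∀ A, QECAlg.IsEffect A → A ∈ QECAlg.correctableAlgebra E →
            QECAlg.IsCorrectedBy 𝓔 R' A) ∧
          (∀ X : QECAlg.POVM Ω H₁,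
            (∀ ω, MeasurableSet ω → X.effect ω ∈ QECAlg.correctableAlgebra E) →
            ∀ ω, MeasurableSet ω → QECAlg.IsCorrectedBy 𝓔 R' (X.effect ω)))) ∧
    -- the algebra contains every correctable sharp effect
    (∀ P, QECAlg.IsSharpEffect P → QECAlg.IsCorrectable 𝓔 P →
      P ∈ QECAlg.correctableAlgebra E) := by
  have hcontr := h𝓔.norm_apply_le hE
  obtain ⟨U, hR, hUU, hUA⟩ := QECAlg.exists_recovery_isometry hcontr
  have hU : ∀ y i, U y i = (QECAlg.coord i ∘L U) y := fun _ _ => rfl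
  have hQE : ∀ j, (QECAlg.rangeSpan E).starProjection ∘L E j = E j := fun j => by
    ext x
    exact Submodule.starProjection_eq_self_iff.2 (QECAlg.mem_rangeSpan E j x)
  refine ⟨QECAlg.span_effects _, ?_, fun R hRec => ?_, fun P hP hc =>
    QECAlg.mem_correctableAlgebra_of_isCorrectable h𝓔 hE hP hc⟩
  · obtain ⟨R, h⟩ := QECAlg.exists_isOperatorSum hU
    exact ⟨R, (hR R).2 h, fun R' h' => ((hR R').1 h').unique h⟩
  have hRs := (hR R).1 hRec
  have hCP := hRs.isCompletelyPositive
  have hdual := fun A => hRs.isDualAt hU A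
  have htr : ∀ ρ, QECAlg.trace (R ρ : H₁ →L[ℂ] H₁) =
      QECAlg.trace ((QECAlg.rangeSpan E).starProjection ∘L (ρ : H₂ →L[ℂ] H₂)) := fun ρ => by
    -- The dual at `1` is `U†U`, the projection onto the closed span of the ranges.
    have h := hdual 1 ρ
    rw [QECAlg.ampl_one] at h
    rw [QECAlg.trace_comp_eq_traceMul, ← hUU]
    exact h
  have hcorr : ∀ A, A ∈ QECAlg.correctableAlgebra E → QECAlg.IsCorrectedBy 𝓔 R A := fun A hA =>
    h𝓔.isCorrectedBy_of_intertwine hE (hdual A) (hUA A hA)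
  refine ⟨hCP, htr, fun htop => ⟨hCP, fun ρ => ?_⟩, fun A _ hA => hcorr A hA,
    fun X hX ω hω => hcorr _ (hX ω hω), fun σ hσ => ?_⟩
  · rw [htr]
    congr 1
    ext x
    exact Submodule.starProjection_eq_self_iff.2 (htop ▸ Submodule.mem_top)
  set Q := (QECAlg.rangeSpan E).starProjection with hQ
  have hadd : ∀ ρ : QECAlg.traceClass H₂, QECAlg.traceMul Q ρ + QECAlg.traceMul (1 - Q) ρ =
      QECAlg.trace (ρ : H₂ →L[ℂ] H₂) := fun ρ => by
    rw [← QECAlg.traceMul_add, add_sub_cancel, QECAlg.traceMul_one]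
  have hcorr' : ∀ A, A ∈ QECAlg.correctableAlgebra E →
      QECAlg.IsCorrectedBy 𝓔 (R + (QECAlg.traceMul (1 - Q)).smulRight σ) A := fun A hA => by
    -- The dual of the completed map sends `A` to `R*(A) + Tr(σA)(1 - Q)`; the second term vanishes
    -- on the ranges of the `Eⱼ`.
    refine h𝓔.isCorrectedBy_of_intertwine hE
      (B := (U.adjoint ∘L QECAlg.ampl A ∘L U) + QECAlg.traceMul A σ • (1 - Q)) (fun ρ => ?_)
      fun j => ?_
    · rw [← QECAlg.traceMul_apply, ← QECAlg.traceMul_apply, QECAlg.traceMul_add,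
        QECAlg.traceMul_smul, LinearMap.add_apply, map_add, LinearMap.smulRight_apply, map_smul,
        smul_eq_mul, mul_comm]
      congr 1
      exact hdual A ρ
    · rw [ContinuousLinearMap.add_comp, hUA A hA, ContinuousLinearMap.smul_comp,
        ContinuousLinearMap.sub_comp, hQE]
      ext x
      simp
  refine ⟨R + (QECAlg.traceMul (1 - Q)).smulRight σ, fun ρ => ?_, ⟨?_, fun ρ => ?_⟩,
    fun A _ hA => hcorr' A hA, fun X hX ω hω => hcorr' _ (hX ω hω)⟩
  · rw [QECAlg.trace_comp_eq_traceMul]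
    rfl
  · exact hCP.add (QECAlg.isCompletelyPositive_traceMul_smulRight
      (QECAlg.one_sub_starProjection_nonneg _) hσ.1)
  · rw [← QECAlg.traceMul_one, LinearMap.add_apply, map_add, LinearMap.smulRight_apply, map_smul,
      QECAlg.traceMul_one, QECAlg.traceMul_one, hσ.2, htr, QECAlg.trace_comp_eq_traceMul,
      smul_eq_mul, mul_one, hadd]
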